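/- **Conventions.** A cartesian category has finite products $X\times Y$, projections $\pi_0,\pi_1$, a terminal object $1$, discard maps $!_X:X\to 1$, copy maps $\Delta_X:X\to X\times X$ and symmetries $\sigma_{X,Y}:X\times Y\to Y\times X$. Composition is written $f;g$ in diagrammatic order, and maps are described by their effect on generalized elements. A *cartesian left-additive category* is a cartesian category in which each object $X$ carries a commutative monoid $+_X:X\times X\to X$, $0_X:1\to X$, such that $+_{X\times Y}$ and $0_{X\times Y}$ are componentwise. (The monoid maps need not be natural.) A *cartesian distributive category* is a cartesian left-additive category in which each object $X$ moreover carries a commutative monoid $\cdot_X:X\times X\to X$, $1_X:1\to X$, componentwise on products, with $x\cdot(y+z)=x\cdot y+x\cdot z$ and $x\cdot 0=0$. **Reverse derivative categories.** A cartesian left-additive category is an *RDC* with *reverse differential combinator* $R$ if $R$ assigns to each $f:X\to Y$ a map $R[f]:X\times Y\to X$ such that, with $D[f]:X\times X\to Y$, $D[f](x,x')=\pi_1\bigl(R[R[f]]((x,0),x')\bigr)$, and, for $g:X\times Y\to Z$, $D_Y[g]((x,y),y')=D[g]((x,y),(0,y'))$: 1. $R[\mathrm{id}](x,x')=x'$;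 $R[\Delta](x,(a,b))=a+b$; $R[+]((x,y),d)=(d,d)$; $R[\sigma_{X,Y}]((x,y),(b,a))=(a,b)$; $R[!](x,\ast)=0$; $R[0_X]=\,!$; $R[f;g](x,z)=R[f]\bigl(x,R[g](f(x),z)\bigr)$; $R[f\times g]((x,x'),(y,y'))=(R[f](x,y),R[g](x',y'))$; and $R$ sends each associator and unitor $\alpha : X\to Y$ of the product to $(x,y)\mapsto\alpha^{-1}(y)$ (which is automatic when these are identities); 2. $R[f](x,y+y')=R[f](x,y)+R[f](x,y')$ and $R[f](x,0)=0$; 3. $D_Y[R[f]]((x,y),y')=R[f](x,y')$ for $f:X\to Y$; 4. $D[D[f]]((x,a),(b,c))=D[D[f]]((x,b),(a,c))$. **Presentations.** Let $\mathrm{Obj}$ be a set of generating objects, $\Sigma$ a set of generating morphisms $w\to v$ between words $w,v\in\mathrm{Obj}^\star$. The left-additive $\Sigma$-terms are built from $\Sigma$, identities and symmetries, and the maps $\Delta_A$, $!_A$, $+_A$, $0_A$ for $A\in\mathrm{Obj}$, by composition and monoidal product. Let $E$ be a set of equations between left-additive $\Sigma$-terms of the same type. The cartesian left-additive category presented by $(\mathrm{Obj},\Sigma,E)$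 has objects $\mathrm{Obj}^\star$, product given by concatenation of words, and as morphisms the left-additive $\Sigma$-terms modulo the congruence generated by $E$ and the axioms of cartesian left-additive categories. The cartesian distributive category presented by $(\mathrm{Obj},\Sigma,E)$ is defined in the same way, with additional generators $\cdot_A$, $1_A$ ($A\in\mathrm{Obj}$) in the terms, and quotienting in addition by the axioms of cartesian distributive categories. **Theorem.** Let $\mathcal C$ be the cartesian left-additive category presented by $(\mathrm{Obj},\Sigma,E)$, and suppose that $\mathcal C$ is an RDC with reverse differential combinator $R$. Let $\mathcal C^*$ be the cartesian distributive category presented by the same data $(\mathrm{Obj},\Sigma,E)$, and let $\iota:\mathcal C\to\mathcal C^*$ be the canonical functor (identity on objects, inclusion on terms). Then $\mathcal C^*$ is an RDC: there is exactly one reverse differential combinator $R^*$ on $\mathcal C^*$ such that $$R^*[\iota f]=\iota(R[f])\ \text{ for all morphisms } f \text{ of } \mathcal C,$$ and, for every object $X$ of $\mathcal C^*$, $$R^*[\cdot_X]:(X\times X)\times X\to X\times X,\quad ((x,y),d)\mapsto(y\cdot d,\;x\cdot d),\qquad R^*[1_X]=\,!:1\times X\to 1 .$$ -/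

import Mathlib

open CategoryTheory MonoidalCategory CartesianMonoidalCategory

set_option linter.unnecessarySeqFocus false

universe u v v'

namespace RevDiff

section Structures

variable (C : Type u) [Category.{v} C] [CartesianMonoidalCategory C] [BraidedCategory C]

/-- A cartesian left-additive category: a cartesian category (products `X ⊗ Y`, terminal object
`𝟙_ C`, symmetry `β_`) in which every object carries a commutative monoid, coherently with the
products.  The monoid maps are not required to be natural. -/
class CartesianLeftAdditive where
  /-- addition on `X` -/
  add (X : C) : X ⊗ X ⟶ X
  /-- the zero of `X` -/
  zero (X : C) : 𝟙_ C ⟶ X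
  add_comm (X : C) : (β_ X X).hom ≫ add X = add X
  add_assoc (X : C) : add X ▷ X ≫ add X = (α_ X X X).hom ≫ X ◁ add X ≫ add X
  zero_add (X : C) : zero X ▷ X ≫ add X = (λ_ X).hom
  add_tensor (X Y : C) : add (X ⊗ Y) = tensorμ X Y X Y ≫ (add X ⊗ₘ add Y)
  zero_tensor (X Y : C) : zero (X ⊗ Y) = (λ_ (𝟙_ C)).inv ≫ (zero X ⊗ₘ zero Y)

/-- A cartesian distributive category: a cartesian left-additive category in which every object
carries in addition a commutative multiplication with unit, which distributes over the addition.
On products the multiplication and the unit are componentwise, like the addition and the zero. -/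
class CartesianDistributive extends CartesianLeftAdditive C where
  /-- multiplication on `X` -/
  mul (X : C) : X ⊗ X ⟶ X
  /-- the unit of `X` -/
  one (X : C) : 𝟙_ C ⟶ X
  mul_comm (X : C) : (β_ X X).hom ≫ mul X = mul X
  mul_assoc (X : C) : mul X ▷ X ≫ mul X = (α_ X X X).hom ≫ X ◁ mul X ≫ mul X
  one_mul (X : C) : one X ▷ X ≫ mul X = (λ_ X).hom
  mul_add (X : C) : X ◁ add X ≫ mul X =
    lift (X ◁ fst X X ≫ mul X) (X ◁ snd X X ≫ mul X) ≫ add X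
  mul_zero (X : C) : X ◁ zero X ≫ mul X = toUnit (X ⊗ 𝟙_ C) ≫ zero X
  mul_tensor (X Y : C) : mul (X ⊗ Y) = tensorμ X Y X Y ≫ (mul X ⊗ₘ mul Y)
  one_tensor (X Y : C) : one (X ⊗ Y) = (λ_ (𝟙_ C)).inv ≫ (one X ⊗ₘ one Y)

/-- The type of reverse differential combinators: `f : X ⟶ Y` is sent to `R f : X ⊗ Y ⟶ X`. -/
abbrev Combinator := ∀ ⦃X Y : C⦄, (X ⟶ Y) → (X ⊗ Y ⟶ X)

end Structures

section RDC

variable {C : Type u} [Category.{v} C] [CartesianMonoidalCategory C] [BraidedCategory C]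
  [CartesianLeftAdditive C]

open CartesianLeftAdditive

/-- The zero morphism `X ⟶ Y`: discard, then zero. -/
def zeroHom (X Y : C) : X ⟶ Y := toUnit X ≫ zero Y

/-- The copy map of `X`. -/
def copyHom (X : C) : X ⟶ X ⊗ X := lift (𝟙 X) (𝟙 X)

/-- The forward derivative `D[f] : X ⊗ X ⟶ Y` of `f : X ⟶ Y`, in terms of `R`:
`(x, x') ↦ π₁ (R[R[f]] ((x, 0), x'))`. -/
def forward (R : Combinator C) {X Y : C} (f : X ⟶ Y) : X ⊗ X ⟶ Y :=
  lift (lift (fst X X) (zeroHom (X ⊗ X) Y)) (snd X X) ≫ R (R f) ≫ snd X Y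

/-- The partial derivative `D_Y[g] : (X ⊗ Y) ⊗ Y ⟶ Z` of `g : X ⊗ Y ⟶ Z` in its second argument:
`((x, y), y') ↦ D[g] ((x, y), (0, y'))`. -/
def partialForward (R : Combinator C) {X Y Z : C} (g : X ⊗ Y ⟶ Z) : (X ⊗ Y) ⊗ Y ⟶ Z :=
  lift (fst (X ⊗ Y) Y) (lift (zeroHom ((X ⊗ Y) ⊗ Y) X) (snd (X ⊗ Y) Y)) ≫ forward R g

/-- `R` satisfies the axioms of a reverse differential combinator and so makes `C` a reverse derivative category.
String diagrams suppress the associators and unitors of the product; the axioms `map_associator`,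
`map_leftUnitor` and `map_rightUnitor` say that `R` treats them as the identities that they are
in a strict monoidal category. -/
structure IsReverseDerivative (R : Combinator C) : Prop where
  -- structural axioms, including the chain rule
  map_id (X : C) : R (𝟙 X) = snd X X
  map_copy (X : C) : R (copyHom X) = snd X (X ⊗ X) ≫ add X
  map_add (X : C) : R (add X) = snd (X ⊗ X) X ≫ copyHom X
  map_twist (X Y : C) : R (β_ X Y).hom = snd (X ⊗ Y) (Y ⊗ X) ≫ (β_ Y X).hom
  map_discard (X : C) : R (toUnit X) = zeroHom (X ⊗ 𝟙_ C) X
  map_zero (X : C) : R (zero X) = toUnit (𝟙_ C ⊗ X)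
  map_associator (X Y Z : C) :
    R (α_ X Y Z).hom = snd ((X ⊗ Y) ⊗ Z) (X ⊗ (Y ⊗ Z)) ≫ (α_ X Y Z).inv
  map_leftUnitor (X : C) : R (λ_ X).hom = snd (𝟙_ C ⊗ X) X ≫ (λ_ X).inv
  map_rightUnitor (X : C) : R (ρ_ X).hom = snd (X ⊗ 𝟙_ C) X ≫ (ρ_ X).inv
  map_comp {X Y Z : C} (f : X ⟶ Y) (g : Y ⟶ Z) :
    R (f ≫ g) = lift (fst X Z) (lift (fst X Z ≫ f) (snd X Z) ≫ R g) ≫ R f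
  map_tensor {X Y X' Y' : C} (f : X ⟶ Y) (g : X' ⟶ Y') :
    R (f ⊗ₘ g) = tensorμ X X' Y Y' ≫ (R f ⊗ₘ R g)
  -- additivity of change
  add_change {X Y : C} (f : X ⟶ Y) :
    X ◁ add Y ≫ R f = lift (X ◁ fst Y Y ≫ R f) (X ◁ snd Y Y ≫ R f) ≫ add X
  zero_change {X Y : C} (f : X ⟶ Y) : X ◁ zero Y ≫ R f = zeroHom (X ⊗ 𝟙_ C) X
  -- linearity of change
  linear_change {X Y : C} (f : X ⟶ Y) : partialForward R (R f) = fst X Y ▷ Y ≫ R f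
  -- symmetry of partial derivatives
  symm_partials {X Y : C} (f : X ⟶ Y) :
    forward R (forward R f) = tensorμ X X X X ≫ forward R (forward R f)

end RDC

section Terms

variable {O : Type u}

/-- The `Σ`-terms built from the generating morphisms `S w v : w ⟶ v` between words in the
generating objects `O`, and from the cartesian left-additive structure: identities and symmetries,
copy, discard, addition and zero of each generating object, sequential composition, and the
monoidal product. -/
inductive Term (S : List O → List O → Type v) : List O → List O → Type (max u v)
  | gen {w v : List O} (s : S w v) : Term S w v
  | id (w : List O) : Term S w w
  | swap (w v : List O) : Term S (w ++ v) (v ++ w)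
  | copy (A : O) : Term S [A] ([A] ++ [A])
  | discard (A : O) : Term S [A] []
  | add (A : O) : Term S ([A] ++ [A]) [A]
  | zero (A : O) : Term S [] [A]
  | comp {w v x : List O} (f : Term S w v) (g : Term S v x) : Term S w x
  | tensor {w v w' v' : List O} (f : Term S w v) (g : Term S w' v') :
      Term S (w ++ w') (v ++ v')

namespace Term

variable {S : List O → List O → Type v}

/-- The identity, between two expressions for the same word. -/
def eqTo {w v : List O} (h : w = v) : Term S w v := h ▸ Term.id w

/-- The copy map of a word, letter by letter. -/
def copyWord : (w : List O) → Term S w (w ++ w)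
  | [] => Term.id []
  | A :: w =>
    (tensor (copy A) (copyWord w)).comp
      ((eqTo (v := [A] ++ (([A] ++ w) ++ w)) (by simp)).comp
        ((tensor (Term.id [A]) (tensor (swap [A] w) (Term.id w))).comp (eqTo (by simp))))

/-- The discard map of a word, letter by letter. -/
def discardWord : (w : List O) → Term S w []
  | [] => Term.id []
  | A :: w => tensor (discard A) (discardWord w)

/-- Relabelling of the generating morphisms. -/
def map {S' : List O → List O → Type v'} (φ : ∀ ⦃w v : List O⦄, S w v → S' w v) :
    {w v : List O} → Term S w v → Term S' w v
  | _, _, gen s => gen (φ s)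
  | _, _, id w => id w
  | _, _, swap w v => swap w v
  | _, _, copy A => copy A
  | _, _, discard A => discard A
  | _, _, add A => add A
  | _, _, zero A => zero A
  | _, _, comp f g => comp (map φ f) (map φ g)
  | _, _, tensor f g => tensor (map φ f) (map φ g)

end Term

/-- A set of equations between `Σ`-terms. -/
abbrev Equations (S : List O → List O → Type v) :=
  ∀ ⦃w v : List O⦄, Term S w v → Term S w v → Prop

open Term in
/-- The congruence on `Σ`-terms generated by the equations `E` and the axioms of cartesian
left-additive categories. -/
inductive Rel {S : List O → List O → Type v} (E : Equations S) :
    {w v : List O} → Term S w v → Term S w v → Prop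
  | eqn {w v : List O} {f g : Term S w v} (h : E f g) : Rel E f g
  -- congruence
  | refl {w v : List O} (f : Term S w v) : Rel E f f
  | symm {w v : List O} {f g : Term S w v} (h : Rel E f g) : Rel E g f
  | trans {w v : List O} {f g k : Term S w v} (h : Rel E f g) (h' : Rel E g k) : Rel E f k
  | comp_congr {w v x : List O} {f f' : Term S w v} {g g' : Term S v x}
      (h : Rel E f f') (h' : Rel E g g') : Rel E (comp f g) (comp f' g')
  | tensor_congr {w v w' v' : List O} {f f' : Term S w v} {g g' : Term S w' v'}
      (h : Rel E f f') (h' : Rel E g g') : Rel E (tensor f g) (tensor f' g')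
  -- strict monoidal category
  | id_comp {w v : List O} (f : Term S w v) : Rel E (comp (Term.id w) f) f
  | comp_id {w v : List O} (f : Term S w v) : Rel E (comp f (Term.id v)) f
  | comp_assoc {w v x y : List O} (f : Term S w v) (g : Term S v x) (k : Term S x y) :
      Rel E (comp (comp f g) k) (comp f (comp g k))
  | tensor_id (w v : List O) : Rel E (tensor (Term.id w) (Term.id v)) (Term.id (w ++ v))
  | tensor_comp {w v x w' v' x' : List O} (f : Term S w v) (g : Term S v x)
      (f' : Term S w' v') (g' : Term S v' x') :
      Rel E (tensor (comp f g) (comp f' g')) (comp (tensor f f') (tensor g g'))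
  | tensor_assoc {w v w' v' w'' v'' : List O} (f : Term S w v) (f' : Term S w' v')
      (f'' : Term S w'' v'') :
      Rel E (comp (tensor (tensor f f') f'') (eqTo (List.append_assoc v v' v'')))
        (comp (eqTo (List.append_assoc w w' w'')) (tensor f (tensor f' f'')))
  | nil_tensor {w v : List O} (f : Term S w v) :
      Rel E (comp (tensor (Term.id []) f) (eqTo (List.nil_append v)))
        (comp (eqTo (List.nil_append w)) f)
  | tensor_nil {w v : List O} (f : Term S w v) :
      Rel E (comp (tensor f (Term.id [])) (eqTo (List.append_nil v)))
        (comp (eqTo (List.append_nil w)) f)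
  -- symmetry
  | swap_natural {w v w' v' : List O} (f : Term S w v) (g : Term S w' v') :
      Rel E (comp (tensor f g) (swap v v')) (comp (swap w w') (tensor g f))
  | swap_swap (w v : List O) : Rel E (comp (swap w v) (swap v w)) (Term.id (w ++ v))
  | hexagon (w v x : List O) :
      Rel E
        (comp (eqTo (List.append_assoc w v x))
          (comp (swap w (v ++ x)) (eqTo (List.append_assoc v x w))))
        (comp (tensor (swap w v) (Term.id x))
          (comp (eqTo (List.append_assoc v w x)) (tensor (Term.id v) (swap w x))))
  -- cartesian structure
  | copy_comm (A : O) : Rel E (comp (copy A) (swap [A] [A])) (copy A)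
  | copy_assoc (A : O) :
      Rel E
        (comp (copy A)
          (comp (tensor (copy A) (Term.id [A])) (eqTo (List.append_assoc [A] [A] [A]))))
        (comp (copy A) (tensor (Term.id [A]) (copy A)))
  | copy_counit (A : O) :
      Rel E (comp (copy A) (comp (tensor (discard A) (Term.id [A])) (eqTo (List.nil_append [A]))))
        (Term.id [A])
  | copy_natural {w v : List O} (f : Term S w v) :
      Rel E (comp f (copyWord v)) (comp (copyWord w) (tensor f f))
  | discard_natural {w v : List O} (f : Term S w v) :
      Rel E (comp f (discardWord v)) (discardWord w)
  -- left-additive structure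
  | add_comm (A : O) : Rel E (comp (swap [A] [A]) (add A)) (add A)
  | add_assoc (A : O) :
      Rel E (comp (tensor (add A) (Term.id [A])) (add A))
        (comp (eqTo (List.append_assoc [A] [A] [A])) (comp (tensor (Term.id [A]) (add A)) (add A)))
  | zero_add (A : O) :
      Rel E (comp (tensor (zero A) (Term.id [A])) (add A)) (eqTo (List.nil_append [A]))

end Terms

section Generic

variable {C : Type u} [Category.{v} C] [MonoidalCategory C] [BraidedCategory C]

theorem counit_left {P W : C} (cP : P ⟶ P ⊗ P) (dP : P ⟶ 𝟙_ C) (cW : W ⟶ W ⊗ W) (dW : W ⟶ 𝟙_ C)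
    (hP : cP ≫ dP ▷ P ≫ (λ_ P).hom = 𝟙 P) (hW : cW ≫ dW ▷ W ≫ (λ_ W).hom = 𝟙 W) :
    ((cP ⊗ₘ cW) ≫ tensorμ P P W W) ≫ ((dP ⊗ₘ dW) ≫ (λ_ (𝟙_ C)).hom) ▷ (P ⊗ W) ≫
      (λ_ (P ⊗ W)).hom = 𝟙 _ := by
  have h1 : tensorμ P P W W ≫ (dP ⊗ₘ dW) ▷ (P ⊗ W) =
      (dP ▷ P ⊗ₘ dW ▷ W) ≫ tensorμ (𝟙_ C) P (𝟙_ C) W := by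
    have := tensorμ_natural dP (𝟙 P) dW (𝟙 W)
    simpa using this.symm
  have h2 : tensorμ (𝟙_ C) P (𝟙_ C) W ≫ (λ_ (𝟙_ C)).hom ▷ (P ⊗ W) ≫ (λ_ (P ⊗ W)).hom =
      (λ_ P).hom ⊗ₘ (λ_ W).hom := by
    simp only [tensorμ, braiding_tensorUnit_right]
    monoidal
  rw [comp_whiskerRight, Category.assoc, Category.assoc, reassoc_of% h1, h2]
  simp only [tensorHom_comp_tensorHom, hP, hW]
  simp

theorem counit_right {P W : C} (cP : P ⟶ P ⊗ P) (dP : P ⟶ 𝟙_ C) (cW : W ⟶ W ⊗ W) (dW : W ⟶ 𝟙_ C)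
    (hP : cP ≫ P ◁ dP ≫ (ρ_ P).hom = 𝟙 P) (hW : cW ≫ W ◁ dW ≫ (ρ_ W).hom = 𝟙 W) :
    ((cP ⊗ₘ cW) ≫ tensorμ P P W W) ≫ (P ⊗ W) ◁ ((dP ⊗ₘ dW) ≫ (λ_ (𝟙_ C)).hom) ≫
      (ρ_ (P ⊗ W)).hom = 𝟙 _ := by
  have h1 : tensorμ P P W W ≫ (P ⊗ W) ◁ (dP ⊗ₘ dW) =
      (P ◁ dP ⊗ₘ W ◁ dW) ≫ tensorμ P (𝟙_ C) W (𝟙_ C) := by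
    have := tensorμ_natural (𝟙 P) dP (𝟙 W) dW
    simpa using this.symm
  have h2 : tensorμ P (𝟙_ C) W (𝟙_ C) ≫ (P ⊗ W) ◁ (λ_ (𝟙_ C)).hom ≫ (ρ_ (P ⊗ W)).hom =
      (ρ_ P).hom ⊗ₘ (ρ_ W).hom := by
    simp only [tensorμ, braiding_tensorUnit_left]
    monoidal
  rw [whiskerLeft_comp, Category.assoc, Category.assoc, reassoc_of% h1, h2]
  simp only [tensorHom_comp_tensorHom, hP, hW]
  simp

theorem counit_mid {P W : C} (cP : P ⟶ P ⊗ P) (dP : P ⟶ 𝟙_ C) (cW : W ⟶ W ⊗ W) (dW : W ⟶ 𝟙_ C)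
    (hP : cP ≫ P ◁ dP ≫ (ρ_ P).hom = 𝟙 P) (hW : cW ≫ dW ▷ W ≫ (λ_ W).hom = 𝟙 W) :
    ((cP ⊗ₘ cW) ≫ tensorμ P P W W) ≫ ((P ◁ dW ≫ (ρ_ P).hom) ⊗ₘ (dP ▷ W ≫ (λ_ W).hom)) = 𝟙 _ := by
  have h1 : tensorμ P P W W ≫ (P ◁ dW ⊗ₘ dP ▷ W) =
      (P ◁ dP ⊗ₘ dW ▷ W) ≫ tensorμ P (𝟙_ C) (𝟙_ C) W := by
    have := tensorμ_natural (𝟙 P) dP dW (𝟙 W)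
    simpa using this.symm
  have h2 : tensorμ P (𝟙_ C) (𝟙_ C) W ≫ ((ρ_ P).hom ⊗ₘ (λ_ W).hom) =
      (ρ_ P).hom ⊗ₘ (λ_ W).hom := by
    simp only [tensorμ, braiding_tensorUnit_right]
    monoidal
  rw [← tensorHom_comp_tensorHom, Category.assoc, reassoc_of% h1, h2]
  simp only [tensorHom_comp_tensorHom, hP, hW]
  simp

end Generic

section Componentwise

variable {C : Type u} [Category.{v} C] [CartesianMonoidalCategory C]

/-- The componentwise constant of a product. -/
def tensorOne {X Y : C} (z : 𝟙_ C ⟶ X) (t : 𝟙_ C ⟶ Y) : 𝟙_ C ⟶ X ⊗ Y :=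
  (λ_ (𝟙_ C)).inv ≫ (z ⊗ₘ t)

theorem tensorOne_nest {P W V : C} (a : 𝟙_ C ⟶ P) (b : 𝟙_ C ⟶ W) (c : 𝟙_ C ⟶ V) :
    tensorOne (tensorOne a b) c = tensorOne a (tensorOne b c) ≫ (α_ P W V).inv := by
  ext <;> simp [tensorOne]

theorem tensorOne_id {V : C} (c : 𝟙_ C ⟶ V) :
    tensorOne (𝟙 (𝟙_ C)) c = c ≫ (λ_ V).inv := by
  ext
  simp [tensorOne]

theorem tensorOne_id' {V : C} (c : 𝟙_ C ⟶ V) :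
    tensorOne c (𝟙 (𝟙_ C)) = c ≫ (ρ_ V).inv := by
  ext
  have h : (λ_ (𝟙_ C)).inv ≫ (ρ_ (𝟙_ C)).hom = 𝟙 _ := toUnit_unique _ _
  simp [tensorOne, reassoc_of% h]

variable [BraidedCategory C]

/-- The componentwise operation on a product. -/
def tensorMul {X Y : C} (a : X ⊗ X ⟶ X) (b : Y ⊗ Y ⟶ Y) : (X ⊗ Y) ⊗ (X ⊗ Y) ⟶ X ⊗ Y :=
  tensorμ X Y X Y ≫ (a ⊗ₘ b)

theorem copy_tensorμ (X : C) :
    (copyHom X ⊗ₘ 𝟙 (X ⊗ X)) ≫ tensorμ X X X X = lift (X ◁ fst X X) (X ◁ snd X X) := by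
  ext <;> simp [copyHom]

theorem tensorMul_comm {X Y : C} {a : X ⊗ X ⟶ X} {b : Y ⊗ Y ⟶ Y} (ha : (β_ X X).hom ≫ a = a)
    (hb : (β_ Y Y).hom ≫ b = b) :
    (β_ (X ⊗ Y) (X ⊗ Y)).hom ≫ tensorMul a b = tensorMul a b := by
  have h : (β_ (X ⊗ Y) (X ⊗ Y)).hom ≫ tensorμ X Y X Y =
      tensorμ X Y X Y ≫ ((β_ X X).hom ⊗ₘ (β_ Y Y).hom) := by
    ext <;> simp [tensorμ]
  rw [tensorMul, reassoc_of% h, tensorHom_comp_tensorHom, ha, hb]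

theorem tensorMul_assoc {X Y : C} {a : X ⊗ X ⟶ X} {b : Y ⊗ Y ⟶ Y}
    (ha : a ▷ X ≫ a = (α_ X X X).hom ≫ X ◁ a ≫ a)
    (hb : b ▷ Y ≫ b = (α_ Y Y Y).hom ≫ Y ◁ b ≫ b) :
    tensorMul a b ▷ (X ⊗ Y) ≫ tensorMul a b =
      (α_ (X ⊗ Y) (X ⊗ Y) (X ⊗ Y)).hom ≫ (X ⊗ Y) ◁ tensorMul a b ≫ tensorMul a b := by
  have h1 : tensorMul a b ▷ (X ⊗ Y) ≫ tensorMul a b =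
      (tensorμ X Y X Y ▷ (X ⊗ Y) ≫ tensorμ (X ⊗ X) (Y ⊗ Y) X Y) ≫
        ((a ▷ X ≫ a) ⊗ₘ (b ▷ Y ≫ b)) := by
    simp only [tensorMul, comp_whiskerRight, Category.assoc, tensorμ_natural_left_assoc,
      tensorHom_comp_tensorHom]
  have h2 : (X ⊗ Y) ◁ tensorMul a b ≫ tensorMul a b =
      ((X ⊗ Y) ◁ tensorμ X Y X Y ≫ tensorμ X Y (X ⊗ X) (Y ⊗ Y)) ≫
        ((X ◁ a ≫ a) ⊗ₘ (Y ◁ b ≫ b)) := by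
    simp only [tensorMul, MonoidalCategory.whiskerLeft_comp, Category.assoc,
      tensorμ_natural_right_assoc, tensorHom_comp_tensorHom]
  have h3 := tensor_associativity X Y X Y X Y
  rw [h1, h2, ha, hb, ← tensorHom_comp_tensorHom, Category.assoc, reassoc_of% h3]
  simp only [Category.assoc]

theorem tensorMul_unit {X Y : C} {a : X ⊗ X ⟶ X} {z : 𝟙_ C ⟶ X} {b : Y ⊗ Y ⟶ Y} {t : 𝟙_ C ⟶ Y}
    (ha : z ▷ X ≫ a = (λ_ X).hom) (hb : t ▷ Y ≫ b = (λ_ Y).hom) :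
    tensorOne z t ▷ (X ⊗ Y) ≫ tensorMul a b = (λ_ (X ⊗ Y)).hom := by
  rw [tensorOne, tensorMul, comp_whiskerRight, Category.assoc, tensorμ_natural_left_assoc,
    tensorHom_comp_tensorHom, ha, hb, ← tensor_left_unitality]

theorem tensorMul_distrib {X Y : C} {a m : X ⊗ X ⟶ X} {b n : Y ⊗ Y ⟶ Y}
    (ha : X ◁ a ≫ m = lift (X ◁ fst X X ≫ m) (X ◁ snd X X ≫ m) ≫ a)
    (hb : Y ◁ b ≫ n = lift (Y ◁ fst Y Y ≫ n) (Y ◁ snd Y Y ≫ n) ≫ b) :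
    (X ⊗ Y) ◁ tensorMul a b ≫ tensorMul m n =
      lift ((X ⊗ Y) ◁ fst _ _ ≫ tensorMul m n) ((X ⊗ Y) ◁ snd _ _ ≫ tensorMul m n) ≫
        tensorMul a b := by
  have h2 : (X ⊗ Y) ◁ tensorMul a b ≫ tensorMul m n =
      ((X ⊗ Y) ◁ tensorμ X Y X Y ≫ tensorμ X Y (X ⊗ X) (Y ⊗ Y)) ≫
        ((X ◁ a ≫ m) ⊗ₘ (Y ◁ b ≫ n)) := by
    simp only [tensorMul, MonoidalCategory.whiskerLeft_comp, Category.assoc,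
      tensorμ_natural_right_assoc, tensorHom_comp_tensorHom]
  have key : ((X ⊗ Y) ◁ tensorμ X Y X Y ≫ tensorμ X Y (X ⊗ X) (Y ⊗ Y)) ≫
      (lift (X ◁ fst X X ≫ m) (X ◁ snd X X ≫ m) ⊗ₘ lift (Y ◁ fst Y Y ≫ n) (Y ◁ snd Y Y ≫ n)) =
      lift ((X ⊗ Y) ◁ fst _ _ ≫ tensorMul m n) ((X ⊗ Y) ◁ snd _ _ ≫ tensorMul m n) ≫
        tensorμ X Y X Y := by
    ext <;> simp [tensorMul] <;> simp only [← Category.assoc] <;> congr 1 <;> ext <;> simp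
  rw [h2, ha, hb, ← tensorHom_comp_tensorHom, ← Category.assoc, key, Category.assoc]
  rfl

theorem tensorMul_annih {X Y : C} {m : X ⊗ X ⟶ X} {z : 𝟙_ C ⟶ X} {n : Y ⊗ Y ⟶ Y} {t : 𝟙_ C ⟶ Y}
    (ha : X ◁ z ≫ m = toUnit _ ≫ z) (hb : Y ◁ t ≫ n = toUnit _ ≫ t) :
    (X ⊗ Y) ◁ tensorOne z t ≫ tensorMul m n = toUnit _ ≫ tensorOne z t := by
  rw [tensorOne, tensorMul, MonoidalCategory.whiskerLeft_comp, Category.assoc,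
    tensorμ_natural_right_assoc, tensorHom_comp_tensorHom, ha, hb, ← tensorHom_comp_tensorHom,
    ← Category.assoc, ← Category.assoc, ← Category.assoc]
  congr 1
  ext

theorem tensorMul_nest {P W V : C} (a : P ⊗ P ⟶ P) (b : W ⊗ W ⟶ W) (c : V ⊗ V ⟶ V) :
    tensorMul (tensorMul a b) c =
      ((α_ P W V).hom ⊗ₘ (α_ P W V).hom) ≫ tensorMul a (tensorMul b c) ≫ (α_ P W V).inv := by
  ext <;> simp [tensorMul]

theorem tensorMul_toUnit {V : C} (c : V ⊗ V ⟶ V) :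
    tensorMul (toUnit (𝟙_ C ⊗ 𝟙_ C)) c = ((λ_ V).hom ⊗ₘ (λ_ V).hom) ≫ c ≫ (λ_ V).inv := by
  ext <;> simp [tensorMul]; congr 1; ext <;> simp [leftUnitor_hom]

theorem tensorMul_toUnit' {V : C} (c : V ⊗ V ⟶ V) :
    tensorMul c (toUnit (𝟙_ C ⊗ 𝟙_ C)) = ((ρ_ V).hom ⊗ₘ (ρ_ V).hom) ≫ c ≫ (ρ_ V).inv := by
  ext <;> simp [tensorMul]; congr 1; ext <;> simp [rightUnitor_hom]

end Componentwise

section Presented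

variable {O : Type u} {S : List O → List O → Type v}

/-- The objects of the category presented by `(O, S, E)`: words in the generating objects. -/
structure Presented (E : Equations S) where
  ofWord ::
  /-- the underlying word -/
  word : List O

namespace Presented

variable {E : Equations S}

/-- Equality of terms modulo the axioms. -/
def setoid (E : Equations S) (w v : List O) : Setoid (Term S w v) where
  r := Rel E
  iseqv := ⟨Rel.refl, Rel.symm, Rel.trans⟩

/-- Morphisms: `Σ`-terms modulo the axioms. -/
def Hom (X Y : Presented E) : Type (max u v) := Quotient (setoid E X.word Y.word)

/-- The class of a term. -/
def cls {w v : List O} (f : Term S w v) : Hom (E := E) ⟨w⟩ ⟨v⟩ := Quotient.mk (setoid E w v) f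

theorem sound {w v : List O} {f g : Term S w v} (h : Rel E f g) : cls (E := E) f = cls g :=
  Quotient.sound (s := setoid E w v) h

instance : Category (Presented E) where
  Hom := Hom
  id X := cls (Term.id X.word)
  comp f g := Quotient.map₂ Term.comp (fun _ _ h _ _ h' => Rel.comp_congr h h') f g
  id_comp f := Quotient.inductionOn f fun f => sound (Rel.id_comp f)
  comp_id f := Quotient.inductionOn f fun f => sound (Rel.comp_id f)
  assoc f g h := Quotient.inductionOn₃ f g h fun f g h => sound (Rel.comp_assoc f g h)

/-- The monoidal product of morphisms. -/
def tens {X Y X' Y' : Presented E} (f : X ⟶ Y) (g : X' ⟶ Y') :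
    (⟨X.word ++ X'.word⟩ : Presented E) ⟶ ⟨Y.word ++ Y'.word⟩ :=
  Quotient.map₂ Term.tensor (fun _ _ h _ _ h' => Rel.tensor_congr h h') f g

/-- The morphism given by a term, as a morphism of the category. -/
def ofTerm {w v : List O} (f : Term S w v) : (⟨w⟩ : Presented E) ⟶ ⟨v⟩ := cls f

theorem ofTerm_sound {w v : List O} {f g : Term S w v} (h : Rel E f g) :
    ofTerm (E := E) f = ofTerm g := sound h

theorem ofTerm_comp {w v x : List O} (f : Term S w v) (g : Term S v x) :
    ofTerm (E := E) (f.comp g) = ofTerm f ≫ ofTerm g := rfl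

theorem ofTerm_id (w : List O) : ofTerm (E := E) (Term.id w) = 𝟙 _ := rfl

theorem ofTerm_tensor {w v w' v' : List O} (f : Term S w v) (g : Term S w' v') :
    ofTerm (E := E) (f.tensor g) = tens (ofTerm f) (ofTerm g) := rfl

@[elab_as_elim]
theorem ind {motive : ∀ {X Y : Presented E}, (X ⟶ Y) → Prop}
    (h : ∀ {w v : List O} (f : Term S w v), motive (ofTerm f)) {X Y : Presented E} (f : X ⟶ Y) :
    motive f :=
  Quotient.inductionOn f fun f => h f

/-- The identity between two expressions for the same word. -/
def eqHom {w v : List O} (h : w = v) : (⟨w⟩ : Presented E) ⟶ ⟨v⟩ := ofTerm (Term.eqTo h)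

@[simp] theorem ofTerm_eqTo {w v : List O} (h : w = v) :
    ofTerm (E := E) (Term.eqTo h) = eqHom h := rfl

@[simp] theorem eqHom_refl (w : List O) : eqHom (E := E) (rfl : w = w) = 𝟙 _ := rfl

@[simp] theorem eqHom_comp {w v x : List O} (h : w = v) (h' : v = x) :
    eqHom (E := E) h ≫ eqHom h' = eqHom (h.trans h') := by
  subst h h'; exact Category.id_comp _

@[simp] theorem eqHom_comp_assoc {w v x : List O} (h : w = v) (h' : v = x) {Y : Presented E}
    (f : (⟨x⟩ : Presented E) ⟶ Y) :
    eqHom (E := E) h ≫ eqHom h' ≫ f = eqHom (h.trans h') ≫ f := by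
  rw [← Category.assoc, eqHom_comp]

theorem tens_id (X Y : Presented E) : tens (𝟙 X) (𝟙 Y) = 𝟙 _ := sound (Rel.tensor_id _ _)

theorem tens_comp {X Y Z X' Y' Z' : Presented E} (f : X ⟶ Y) (g : Y ⟶ Z) (f' : X' ⟶ Y')
    (g' : Y' ⟶ Z') : tens (f ≫ g) (f' ≫ g') = tens f f' ≫ tens g g' := by
  revert f g f' g'
  rintro ⟨f⟩ ⟨g⟩ ⟨f'⟩ ⟨g'⟩
  exact sound (Rel.tensor_comp f g f' g')

theorem tens_eqHom {w v w' v' : List O} (h : w = v) (h' : w' = v') :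
    tens (eqHom (E := E) h) (eqHom h') = eqHom (by rw [h, h']) := by
  subst h h'
  exact tens_id _ _

/-- The isomorphism between two expressions for the same word. -/
def eqIso {w v : List O} (h : w = v) : (⟨w⟩ : Presented E) ≅ ⟨v⟩ where
  hom := eqHom h
  inv := eqHom h.symm

instance : MonoidalCategoryStruct (Presented E) where
  tensorObj X Y := ⟨X.word ++ Y.word⟩
  tensorUnit := ⟨[]⟩
  tensorHom f g := tens f g
  whiskerLeft X _ _ f := tens (𝟙 X) f
  whiskerRight f Y := tens f (𝟙 Y)
  associator X Y Z := eqIso (List.append_assoc X.word Y.word Z.word)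
  leftUnitor X := eqIso (List.nil_append X.word)
  rightUnitor X := eqIso (List.append_nil X.word)

theorem tens_assoc {X Y X' Y' X'' Y'' : Presented E} (f : X ⟶ Y) (g : X' ⟶ Y') (h : X'' ⟶ Y'') :
    tens (tens f g) h ≫ eqHom (List.append_assoc Y.word Y'.word Y''.word) =
      eqHom (List.append_assoc X.word X'.word X''.word) ≫ tens f (tens g h) := by
  induction f using ind
  induction g using ind
  induction h using ind
  exact sound (Rel.tensor_assoc _ _ _)

theorem nil_tens {X Y : Presented E} (f : X ⟶ Y) :
    tens (𝟙 ⟨[]⟩) f ≫ eqHom (List.nil_append Y.word) = eqHom (List.nil_append X.word) ≫ f := by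
  induction f using ind
  exact sound (Rel.nil_tensor _)

theorem tens_nil {X Y : Presented E} (f : X ⟶ Y) :
    tens f (𝟙 ⟨[]⟩) ≫ eqHom (List.append_nil Y.word) = eqHom (List.append_nil X.word) ≫ f := by
  induction f using ind
  exact sound (Rel.tensor_nil _)

/-- The monoidal structure: concatenation of words, and the monoidal product of terms. -/
instance : MonoidalCategory (Presented E) :=
  MonoidalCategory.ofTensorHom
    (id_tensorHom_id := fun X Y => tens_id X Y)
    (id_tensorHom := fun _ _ _ _ => rfl)
    (tensorHom_id := fun _ _ => rfl)
    (tensorHom_comp_tensorHom := fun f f' g g' => (tens_comp f g f' g').symm)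
    (associator_naturality := fun f g h => tens_assoc f g h)
    (leftUnitor_naturality := fun f => nil_tens f)
    (rightUnitor_naturality := fun f => tens_nil f)
    (pentagon := fun W X Y Z => by
      change tens (eqHom _) (eqHom rfl) ≫ eqHom _ ≫ tens (eqHom rfl) (eqHom _) = eqHom _ ≫ eqHom _
      rw [tens_eqHom, tens_eqHom, eqHom_comp, eqHom_comp, eqHom_comp])
    (triangle := fun X Y => by
      change eqHom _ ≫ tens (eqHom rfl) (eqHom _) = tens (eqHom _) (eqHom rfl)
      rw [tens_eqHom, tens_eqHom, eqHom_comp])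

/-- The symmetry. -/
def swapHom (X Y : Presented E) : X ⊗ Y ⟶ Y ⊗ X := ofTerm (Term.swap X.word Y.word)

theorem swapHom_swapHom (X Y : Presented E) : swapHom X Y ≫ swapHom Y X = 𝟙 _ :=
  sound (Rel.swap_swap _ _)

theorem swapHom_natural {X Y X' Y' : Presented E} (f : X ⟶ Y) (g : X' ⟶ Y') :
    (f ⊗ₘ g) ≫ swapHom Y Y' = swapHom X X' ≫ (g ⊗ₘ f) := by
  induction f using ind
  induction g using ind
  exact sound (Rel.swap_natural _ _)

theorem swapHom_hexagon (X Y Z : Presented E) :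
    (α_ X Y Z).hom ≫ swapHom X (Y ⊗ Z) ≫ (α_ Y Z X).hom =
      (swapHom X Y ▷ Z) ≫ (α_ Y X Z).hom ≫ (Y ◁ swapHom X Z) :=
  sound (Rel.hexagon _ _ _)

/-- The symmetry, as an isomorphism. -/
def swapIso (X Y : Presented E) : X ⊗ Y ≅ Y ⊗ X where
  hom := swapHom X Y
  inv := swapHom Y X
  hom_inv_id := swapHom_swapHom X Y
  inv_hom_id := swapHom_swapHom Y X

instance : BraidedCategory (Presented E) where
  braiding := swapIso
  braiding_naturality_right X _ _ f := by
    rw [← id_tensorHom, ← tensorHom_id]; exact swapHom_natural _ _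
  braiding_naturality_left f X := by
    rw [← id_tensorHom, ← tensorHom_id]; exact swapHom_natural _ _
  hexagon_forward := swapHom_hexagon
  hexagon_reverse X Y Z := by
    have h : α_ Z X Y ≪≫ swapIso Z (X ⊗ Y) ≪≫ α_ X Y Z =
        whiskerRightIso (swapIso Z X) Y ≪≫ α_ X Z Y ≪≫ whiskerLeftIso X (swapIso Z Y) :=
      Iso.ext (swapHom_hexagon Z X Y)
    have h' := congrArg Iso.inv h
    simp only [Iso.trans_inv, whiskerRightIso_inv, whiskerLeftIso_inv, Category.assoc] at h'
    exact h'

/-- The discard map. -/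
def discardHom (X : Presented E) : X ⟶ 𝟙_ (Presented E) := ofTerm (Term.discardWord X.word)

/-- The copy map. -/
def copyWordHom (X : Presented E) : X ⟶ X ⊗ X := ofTerm (Term.copyWord X.word)

theorem eq_discardHom {X : Presented E} (f : X ⟶ 𝟙_ (Presented E)) : f = discardHom X := by
  have h : f ≫ discardHom (𝟙_ (Presented E)) = discardHom X := by
    exact Quotient.inductionOn f fun f => ofTerm_sound (Rel.discard_natural f)
  exact (Category.comp_id f).symm.trans h

theorem copyWordHom_natural {X Y : Presented E} (f : X ⟶ Y) :
    f ≫ copyWordHom Y = copyWordHom X ≫ (f ⊗ₘ f) := by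
  induction f using ind
  exact ofTerm_sound (Rel.copy_natural _)

/-- The copy map of a generating object. -/
def copyGen (A : O) : (⟨[A]⟩ : Presented E) ⟶ ⟨[A]⟩ ⊗ ⟨[A]⟩ := ofTerm (Term.copy A)

/-- The discard map of a generating object. -/
def discardGen (A : O) : (⟨[A]⟩ : Presented E) ⟶ 𝟙_ (Presented E) := ofTerm (Term.discard A)

theorem copyGen_left (A : O) :
    copyGen (E := E) A ≫ discardGen A ▷ ⟨[A]⟩ ≫ (λ_ (⟨[A]⟩ : Presented E)).hom = 𝟙 _ :=
  ofTerm_sound (Rel.copy_counit A)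

theorem copyGen_comm (A : O) :
    copyGen (E := E) A ≫ (β_ (⟨[A]⟩ : Presented E) ⟨[A]⟩).hom = copyGen A :=
  ofTerm_sound (Rel.copy_comm A)

theorem copyGen_right (A : O) :
    copyGen (E := E) A ≫ ⟨[A]⟩ ◁ discardGen A ≫ (ρ_ (⟨[A]⟩ : Presented E)).hom = 𝟙 _ := by
  rw [← copyGen_left A]
  conv_rhs => rw [← copyGen_comm A]
  rw [Category.assoc, ← BraidedCategory.braiding_naturality_right_assoc, braiding_leftUnitor]

theorem tensorμ_eq (w w' v v' : List O) :
    tensorμ (⟨w⟩ : Presented E) ⟨w'⟩ ⟨v⟩ ⟨v'⟩ =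
      eqHom (w := (w ++ w') ++ (v ++ v')) (v := w ++ ((w' ++ v) ++ v')) (by simp) ≫
        tens (𝟙 (⟨w⟩ : Presented E)) (tens (ofTerm (Term.swap w' v)) (𝟙 (⟨v'⟩ : Presented E))) ≫
          eqHom (w := w ++ ((v ++ w') ++ v')) (v := (w ++ v) ++ (w' ++ v')) (by simp) := by
  have h1 : (α_ (⟨w⟩ : Presented E) ⟨w'⟩ (⟨v⟩ ⊗ ⟨v'⟩)).hom ≫
      (⟨w⟩ : Presented E) ◁ (α_ (⟨w'⟩ : Presented E) ⟨v⟩ ⟨v'⟩).inv =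
      eqHom (w := (w ++ w') ++ (v ++ v')) (v := w ++ ((w' ++ v) ++ v')) (by simp) := by
    change eqHom _ ≫ tens (eqHom rfl) (eqHom _) = _
    rw [tens_eqHom, eqHom_comp]
  have h2 : (⟨w⟩ : Presented E) ◁ (α_ (⟨v⟩ : Presented E) ⟨w'⟩ ⟨v'⟩).hom ≫
      (α_ (⟨w⟩ : Presented E) ⟨v⟩ (⟨w'⟩ ⊗ ⟨v'⟩)).inv =
      eqHom (w := w ++ ((v ++ w') ++ v')) (v := (w ++ v) ++ (w' ++ v')) (by simp) := by
    change tens (eqHom rfl) (eqHom _) ≫ eqHom _ = _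
    rw [tens_eqHom, eqHom_comp]
  rw [tensorμ, h2, reassoc_of% h1]
  rfl

theorem copyWordHom_cons (A : O) (w : List O) :
    copyWordHom (E := E) ⟨A :: w⟩ =
      (copyGen A ⊗ₘ copyWordHom ⟨w⟩) ≫ tensorμ (⟨[A]⟩ : Presented E) ⟨[A]⟩ ⟨w⟩ ⟨w⟩ := by
  rw [tensorμ_eq]
  rfl

theorem discardHom_cons (A : O) (w : List O) :
    discardHom (E := E) ⟨A :: w⟩ =
      (discardGen A ⊗ₘ discardHom ⟨w⟩) ≫ (λ_ (𝟙_ (Presented E))).hom :=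
  (Category.comp_id _).symm

theorem copyWordHom_left (X : Presented E) :
    copyWordHom X ≫ discardHom X ▷ X ≫ (λ_ X).hom = 𝟙 X := by
  obtain ⟨w⟩ := X
  induction w with
  | nil =>
    change 𝟙 _ ≫ tens (𝟙 _) (𝟙 _) ≫ 𝟙 _ = 𝟙 _
    rw [tens_id, Category.id_comp, Category.id_comp]
  | cons A w ih =>
    rw [copyWordHom_cons, discardHom_cons]
    exact counit_left (copyGen A) (discardGen A) _ _ (copyGen_left A) ih

theorem copyWordHom_right (X : Presented E) :
    copyWordHom X ≫ X ◁ discardHom X ≫ (ρ_ X).hom = 𝟙 X := by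
  obtain ⟨w⟩ := X
  induction w with
  | nil =>
    change 𝟙 _ ≫ tens (𝟙 _) (𝟙 _) ≫ 𝟙 _ = 𝟙 _
    rw [tens_id, Category.id_comp, Category.id_comp]
  | cons A w ih =>
    rw [copyWordHom_cons, discardHom_cons]
    exact counit_right (copyGen A) (discardGen A) _ _ (copyGen_right A) ih

/-- The first projection. -/
def fstHom (X Y : Presented E) : X ⊗ Y ⟶ X := X ◁ discardHom Y ≫ (ρ_ X).hom

/-- The second projection. -/
def sndHom (X Y : Presented E) : X ⊗ Y ⟶ Y := discardHom X ▷ Y ≫ (λ_ Y).hom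

/-- Pairing. -/
def pair {T X Y : Presented E} (f : T ⟶ X) (g : T ⟶ Y) : T ⟶ X ⊗ Y := copyWordHom T ≫ (f ⊗ₘ g)

theorem comp_discardHom {X Y : Presented E} (f : X ⟶ Y) : f ≫ discardHom Y = discardHom X :=
  eq_discardHom _

theorem pair_fst {T X Y : Presented E} (f : T ⟶ X) (g : T ⟶ Y) : pair f g ≫ fstHom X Y = f := by
  have h : (f ⊗ₘ g) ≫ X ◁ discardHom Y = T ◁ discardHom T ≫ f ▷ _ := by
    rw [← id_tensorHom, ← id_tensorHom, ← tensorHom_id, tensorHom_comp_tensorHom,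
      tensorHom_comp_tensorHom, comp_discardHom]
    simp
  rw [pair, fstHom, Category.assoc, reassoc_of% h, rightUnitor_naturality]
  have := copyWordHom_right T
  rw [← Category.assoc, ← Category.assoc, Category.assoc (copyWordHom T), this, Category.id_comp]

theorem pair_snd {T X Y : Presented E} (f : T ⟶ X) (g : T ⟶ Y) : pair f g ≫ sndHom X Y = g := by
  have h : (f ⊗ₘ g) ≫ discardHom X ▷ Y = discardHom T ▷ T ≫ _ ◁ g := by
    rw [← id_tensorHom, ← tensorHom_id, ← tensorHom_id, tensorHom_comp_tensorHom,
      tensorHom_comp_tensorHom, comp_discardHom]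
    simp
  rw [pair, sndHom, Category.assoc, reassoc_of% h, leftUnitor_naturality]
  have := copyWordHom_left T
  rw [← Category.assoc, ← Category.assoc, Category.assoc (copyWordHom T), this, Category.id_comp]

theorem hom_ext_cons {T : Presented E} (A : O) (W : Presented E) (f g : T ⟶ ⟨[A]⟩ ⊗ W)
    (h₁ : f ≫ fstHom _ _ = g ≫ fstHom _ _) (h₂ : f ≫ sndHom _ _ = g ≫ sndHom _ _) : f = g := by
  have key : ∀ k : T ⟶ ⟨[A]⟩ ⊗ W, k = pair (k ≫ fstHom _ _) (k ≫ sndHom _ _) := by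
    intro k
    have e : copyWordHom (⟨[A]⟩ ⊗ W) ≫ (fstHom (⟨[A]⟩ : Presented E) W ⊗ₘ sndHom ⟨[A]⟩ W) = 𝟙 _ := by
      have e' := counit_mid (copyGen A) (discardGen A) (copyWordHom W) (discardHom W)
        (copyGen_right A) (copyWordHom_left W)
      rw [← copyWordHom_cons] at e'
      have hd : discardHom (⟨[A]⟩ : Presented E) = discardGen A := (eq_discardHom _).symm
      rw [fstHom, sndHom, hd]
      exact e'
    rw [pair, ← tensorHom_comp_tensorHom, ← Category.assoc, ← copyWordHom_natural, Category.assoc, e,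
      Category.comp_id]
  rw [key f, key g, h₁, h₂]

theorem assoc_fst (X Y Z : Presented E) :
    (α_ X Y Z).hom ≫ fstHom _ _ = fstHom _ _ ≫ fstHom _ _ := by
  have : discardHom (Y ⊗ Z) = Y ◁ discardHom Z ≫ (ρ_ Y).hom ≫ discardHom Y :=
    (eq_discardHom _).symm
  simp [fstHom, this]

theorem assoc_snd_fst (X Y Z : Presented E) :
    (α_ X Y Z).hom ≫ sndHom _ _ ≫ fstHom _ _ = fstHom _ _ ≫ sndHom _ _ := by
  have h : fstHom (X ⊗ Y) Z = (α_ X Y Z).hom ≫ X ◁ (Y ◁ discardHom Z ≫ (ρ_ Y).hom) := by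
    simp [fstHom]
  rw [h, Category.assoc, sndHom, sndHom, whisker_exchange_assoc, leftUnitor_naturality, fstHom]
  simp

theorem assoc_snd_snd (X Y Z : Presented E) :
    (α_ X Y Z).hom ≫ sndHom _ _ ≫ sndHom _ _ = sndHom _ _ := by
  have : discardHom (X ⊗ Y) = discardHom X ▷ Y ≫ (λ_ Y).hom ≫ discardHom Y :=
    (eq_discardHom _).symm
  simp [sndHom, this]

theorem hom_ext_all {T : Presented E} (X Y : Presented E) (f g : T ⟶ X ⊗ Y)
    (h₁ : f ≫ fstHom _ _ = g ≫ fstHom _ _) (h₂ : f ≫ sndHom _ _ = g ≫ sndHom _ _) : f = g := by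
  obtain ⟨w⟩ := X
  induction w generalizing T with
  | nil =>
    have e : sndHom (⟨[]⟩ : Presented E) Y = 𝟙 _ := by
      change tens (𝟙 _) (𝟙 _) ≫ 𝟙 _ = 𝟙 _
      rw [tens_id, Category.id_comp]
    rw [e] at h₂
    exact (Category.comp_id f).symm.trans (h₂.trans (Category.comp_id g))
  | cons A w ih =>
    rw [← cancel_mono (α_ (⟨[A]⟩ : Presented E) ⟨w⟩ Y).hom]
    apply hom_ext_cons
    · simp only [Category.assoc, assoc_fst]
      have h := congrArg (fun k => k ≫ fstHom (⟨[A]⟩ : Presented E) ⟨w⟩) h₁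
      exact (Category.assoc _ _ _).symm.trans (h.trans (Category.assoc _ _ _))
    · apply ih
      · simp only [Category.assoc, assoc_snd_fst]
        have h := congrArg (fun k => k ≫ sndHom (⟨[A]⟩ : Presented E) ⟨w⟩) h₁
        exact (Category.assoc _ _ _).symm.trans (h.trans (Category.assoc _ _ _))
      · simp only [Category.assoc, assoc_snd_snd]
        exact h₂

instance : CartesianMonoidalCategory (Presented E) where
  isTerminalTensorUnit := Limits.IsTerminal.ofUniqueHom discardHom fun _ f => eq_discardHom f
  fst := fstHom
  snd := sndHom
  fst_def _ _ := rfl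
  snd_def _ _ := rfl
  tensorProductIsBinaryProduct X Y := Limits.BinaryFan.IsLimit.mk _ pair pair_fst pair_snd
    fun f g _ h₁ h₂ => hom_ext_all X Y _ _ (h₁.trans (pair_fst f g).symm)
      (h₂.trans (pair_snd f g).symm)

/-- The letterwise extension to words of an operation on the generating objects. -/
def mulWord (a : ∀ A : O, (⟨[A]⟩ : Presented E) ⊗ ⟨[A]⟩ ⟶ ⟨[A]⟩) :
    (w : List O) → ((⟨w⟩ : Presented E) ⊗ ⟨w⟩ ⟶ ⟨w⟩)
  | [] => toUnit (𝟙_ (Presented E) ⊗ 𝟙_ (Presented E))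
  | A :: w => tensorMul (a A) (mulWord a w)

/-- The letterwise extension to words of a constant on the generating objects. -/
def oneWord (z : ∀ A : O, 𝟙_ (Presented E) ⟶ (⟨[A]⟩ : Presented E)) :
    (w : List O) → (𝟙_ (Presented E) ⟶ (⟨w⟩ : Presented E))
  | [] => 𝟙 (𝟙_ (Presented E))
  | A :: w => tensorOne (z A) (oneWord z w)

section Words

variable {a m : ∀ A : O, (⟨[A]⟩ : Presented E) ⊗ ⟨[A]⟩ ⟶ ⟨[A]⟩}
  {z : ∀ A : O, 𝟙_ (Presented E) ⟶ (⟨[A]⟩ : Presented E)}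

theorem mulWord_comm (ha : ∀ A, (β_ _ _).hom ≫ a A = a A) (w : List O) :
    (β_ (⟨w⟩ : Presented E) ⟨w⟩).hom ≫ mulWord a w = mulWord a w := by
  induction w with
  | nil => exact toUnit_unique (C := Presented E) _ _
  | cons A w ih => exact tensorMul_comm (ha A) ih

theorem mulWord_assoc
    (ha : ∀ A, a A ▷ _ ≫ a A = (α_ _ _ _).hom ≫ (⟨[A]⟩ : Presented E) ◁ a A ≫ a A) (w : List O) :
    mulWord a w ▷ (⟨w⟩ : Presented E) ≫ mulWord a w =
      (α_ _ _ _).hom ≫ (⟨w⟩ : Presented E) ◁ mulWord a w ≫ mulWord a w := by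
  induction w with
  | nil => exact toUnit_unique (C := Presented E) _ _
  | cons A w ih => exact tensorMul_assoc (ha A) ih

theorem mulWord_unit (ha : ∀ A, z A ▷ _ ≫ a A = (λ_ (⟨[A]⟩ : Presented E)).hom) (w : List O) :
    oneWord z w ▷ (⟨w⟩ : Presented E) ≫ mulWord a w = (λ_ _).hom := by
  induction w with
  | nil => exact toUnit_unique (C := Presented E) _ _
  | cons A w ih => exact tensorMul_unit (ha A) ih

theorem mulWord_distrib
    (ha : ∀ A, (⟨[A]⟩ : Presented E) ◁ a A ≫ m A =
      lift ((⟨[A]⟩ : Presented E) ◁ fst _ _ ≫ m A) ((⟨[A]⟩ : Presented E) ◁ snd _ _ ≫ m A) ≫ a A)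
    (w : List O) :
    (⟨w⟩ : Presented E) ◁ mulWord a w ≫ mulWord m w =
      lift ((⟨w⟩ : Presented E) ◁ fst _ _ ≫ mulWord m w)
        ((⟨w⟩ : Presented E) ◁ snd _ _ ≫ mulWord m w) ≫ mulWord a w := by
  induction w with
  | nil => exact toUnit_unique (C := Presented E) _ _
  | cons A w ih => exact tensorMul_distrib (ha A) ih

theorem mulWord_annih
    (ha : ∀ A, (⟨[A]⟩ : Presented E) ◁ z A ≫ m A = toUnit _ ≫ z A) (w : List O) :
    (⟨w⟩ : Presented E) ◁ oneWord z w ≫ mulWord m w = toUnit _ ≫ oneWord z w := by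
  induction w with
  | nil => exact toUnit_unique (C := Presented E) _ _
  | cons A w ih => exact tensorMul_annih (ha A) ih

theorem mulWord_append (w v : List O) :
    mulWord a (w ++ v) = tensorMul (mulWord a w) (mulWord a v) := by
  induction w with
  | nil =>
    refine Eq.trans ?_ (tensorMul_toUnit (mulWord a v)).symm
    change _ = tens (𝟙 _) (𝟙 _) ≫ mulWord a v ≫ 𝟙 _
    rw [tens_id, Category.comp_id]
    exact (Category.id_comp _).symm
  | cons A w ih =>
    refine Eq.trans ?_ (tensorMul_nest (a A) (mulWord a w) (mulWord a v)).symm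
    rw [← ih]
    change _ = tens (𝟙 _) (𝟙 _) ≫ mulWord a (A :: (w ++ v)) ≫ 𝟙 _
    rw [tens_id, Category.comp_id]
    exact (Category.id_comp _).symm

theorem oneWord_append (w v : List O) :
    oneWord z (w ++ v) = tensorOne (oneWord z w) (oneWord z v) := by
  induction w with
  | nil =>
    refine Eq.trans ?_ (tensorOne_id (oneWord z v)).symm
    exact (Category.comp_id _).symm
  | cons A w ih =>
    refine Eq.trans ?_ (tensorOne_nest (z A) (oneWord z w) (oneWord z v)).symm
    rw [← ih]
    exact (Category.comp_id _).symm

theorem mulWord_singleton (A : O) : mulWord a [A] = a A := by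
  refine (tensorMul_toUnit' (a A)).trans ?_
  change tens (𝟙 _) (𝟙 _) ≫ a A ≫ 𝟙 _ = _
  rw [tens_id, Category.comp_id]
  exact Category.id_comp _

theorem oneWord_singleton (A : O) : oneWord z [A] = z A :=
  (tensorOne_id' (z A)).trans (Category.comp_id _)

end Words

/-- The addition of a generating object. -/
def addGen (A : O) : (⟨[A]⟩ : Presented E) ⊗ ⟨[A]⟩ ⟶ ⟨[A]⟩ := ofTerm (Term.add A)

/-- The zero of a generating object. -/
def zeroGen (A : O) : 𝟙_ (Presented E) ⟶ (⟨[A]⟩ : Presented E) := ofTerm (Term.zero A)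

/-- The category presented by `(O, S, E)` is cartesian left-additive. -/
instance : CartesianLeftAdditive (Presented E) where
  add X := mulWord addGen X.word
  zero X := oneWord zeroGen X.word
  add_comm X := mulWord_comm (fun A => ofTerm_sound (Rel.add_comm A)) X.word
  add_assoc X := mulWord_assoc (fun A => ofTerm_sound (Rel.add_assoc A)) X.word
  zero_add X := mulWord_unit (fun A => ofTerm_sound (Rel.zero_add A)) X.word
  add_tensor X Y := mulWord_append X.word Y.word
  zero_tensor X Y := oneWord_append X.word Y.word

theorem add_singleton (A : O) :
    CartesianLeftAdditive.add (⟨[A]⟩ : Presented E) = ofTerm (Term.add A) :=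
  mulWord_singleton A

theorem zero_singleton (A : O) :
    CartesianLeftAdditive.zero (⟨[A]⟩ : Presented E) = ofTerm (Term.zero A) :=
  oneWord_singleton A

theorem copy_singleton (A : O) :
    copyHom (⟨[A]⟩ : Presented E) = ofTerm (Term.copy A) := by
  change _ = copyGen A
  have hd : discardHom (⟨[A]⟩ : Presented E) = discardGen A := (eq_discardHom _).symm
  apply CartesianMonoidalCategory.hom_ext
  · rw [copyHom, lift_fst]
    change _ = copyGen A ≫ fstHom _ _
    rw [fstHom, hd, copyGen_right]
  · rw [copyHom, lift_snd]
    change _ = copyGen A ≫ sndHom _ _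
    rw [sndHom, hd, copyGen_left]

end Presented

end Presented

section Distributive

variable {O : Type u} {S : List O → List O → Type v}

/-- The generating morphisms of `S`, and a multiplication and a unit for each generating object. -/
inductive DistGen (S : List O → List O → Type v) : List O → List O → Type (max u v)
  | gen {w v : List O} (s : S w v) : DistGen S w v
  | mul (A : O) : DistGen S ([A] ++ [A]) [A]
  | one (A : O) : DistGen S [] [A]

namespace Term

/-- A left-additive term, as a term that may also use multiplication and unit. -/
def incl {w v : List O} (f : Term S w v) : Term (DistGen S) w v :=
  f.map fun _ _ s => DistGen.gen s

/-- The multiplication of a generating object. -/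
def mul (A : O) : Term (DistGen S) ([A] ++ [A]) [A] := gen (DistGen.mul A)

/-- The unit of a generating object. -/
def one (A : O) : Term (DistGen S) [] [A] := gen (DistGen.one A)

end Term

open Term in
/-- The equations `E`, and the axioms of multiplication and unit. -/
inductive DistEquations (E : Equations S) : Equations (DistGen S)
  | eqn {w v : List O} {f g : Term S w v} (h : E f g) : DistEquations E f.incl g.incl
  | mul_comm (A : O) : DistEquations E (comp (swap [A] [A]) (mul A)) (mul A)
  | mul_assoc (A : O) :
      DistEquations E (comp (tensor (mul A) (Term.id [A])) (mul A))
        (comp (eqTo (List.append_assoc [A] [A] [A])) (comp (tensor (Term.id [A]) (mul A)) (mul A)))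
  | one_mul (A : O) :
      DistEquations E (comp (tensor (one A) (Term.id [A])) (mul A)) (eqTo (List.nil_append [A]))
  | mul_add (A : O) :
      DistEquations E
        (comp (tensor (Term.id [A]) (add A)) (mul A))
        (comp (tensor (copy A) (Term.id ([A] ++ [A])))
          (comp (eqTo (v := [A] ++ (([A] ++ [A]) ++ [A])) (by simp))
            (comp (tensor (Term.id [A]) (tensor (swap [A] [A]) (Term.id [A])))
              (comp (eqTo (v := ([A] ++ [A]) ++ ([A] ++ [A])) (by simp))
                (comp (tensor (mul A) (mul A)) (add A))))))
  | mul_zero (A : O) :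
      DistEquations E
        (comp (tensor (Term.id [A]) (zero A)) (mul A))
        (comp (eqTo (List.append_nil [A])) (comp (discard A) (zero A)))

namespace Term

theorem map_eqTo {S' : List O → List O → Type v'} (φ : ∀ ⦃w v : List O⦄, S w v → S' w v)
    {w v : List O} (h : w = v) : (eqTo h : Term S w v).map φ = eqTo h := by
  subst h; rfl

theorem map_discardWord {S' : List O → List O → Type v'} (φ : ∀ ⦃w v : List O⦄, S w v → S' w v)
    (w : List O) : (discardWord w : Term S w []).map φ = discardWord w := by
  induction w with
  | nil => rfl
  | cons A w ih => exact congrArg (tensor (discard A)) ih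

theorem map_copyWord {S' : List O → List O → Type v'} (φ : ∀ ⦃w v : List O⦄, S w v → S' w v)
    (w : List O) : (copyWord w : Term S w (w ++ w)).map φ = copyWord w := by
  induction w with
  | nil => rfl
  | cons A w ih => simp only [copyWord, map, map_eqTo, ih]

end Term

theorem Rel.incl {E : Equations S} {w v : List O} {f g : Term S w v} (h : Rel E f g) :
    Rel (DistEquations E) f.incl g.incl := by
  induction h with
  | eqn h => exact .eqn (.eqn h)
  | refl f => exact .refl _
  | symm _ ih => exact .symm ih
  | trans _ _ ih ih' => exact .trans ih ih'
  | comp_congr _ _ ih ih' => exact .comp_congr ih ih'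
  | tensor_congr _ _ ih ih' => exact .tensor_congr ih ih'
  | _ =>
    simp only [Term.incl, Term.map, Term.map_eqTo, Term.map_copyWord, Term.map_discardWord]
    first
    | exact .id_comp _
    | exact .comp_id _
    | exact .comp_assoc _ _ _
    | exact .tensor_id _ _
    | exact .tensor_comp _ _ _ _
    | exact .tensor_assoc _ _ _
    | exact .nil_tensor _
    | exact .tensor_nil _
    | exact .swap_natural _ _
    | exact .swap_swap _ _
    | exact .hexagon _ _ _
    | exact .copy_comm _
    | exact .copy_assoc _
    | exact .copy_counit _
    | exact .copy_natural _
    | exact .discard_natural _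
    | exact .add_comm _
    | exact .add_assoc _
    | exact .zero_add _

/-- The cartesian distributive category presented by `(O, S, E)`, for equations `E` between
left-additive terms. -/
abbrev DistPresented (E : Equations S) := Presented (DistEquations E)

/-- The canonical functor from the cartesian left-additive category presented by `(O, S, E)` to the
cartesian distributive category presented by the same data: the identity on objects, and the
inclusion on terms. -/
def inclusion (E : Equations S) : Presented E ⥤ DistPresented E where
  obj X := ⟨X.word⟩
  map f := Quotient.map Term.incl (fun _ _ h => Rel.incl h) f
  map_id _ := rfl
  map_comp f g := Quotient.inductionOn₂ f g fun _ _ => rfl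

namespace DistPresented

variable {E : Equations S}

/-- The multiplication of a generating object. -/
def mulGen (A : O) : (⟨[A]⟩ : DistPresented E) ⊗ ⟨[A]⟩ ⟶ ⟨[A]⟩ := Presented.ofTerm (Term.mul A)

/-- The unit of a generating object. -/
def oneGen (A : O) : 𝟙_ (DistPresented E) ⟶ (⟨[A]⟩ : DistPresented E) :=
  Presented.ofTerm (Term.one A)

theorem mulGen_add (A : O) :
    (⟨[A]⟩ : DistPresented E) ◁ Presented.addGen A ≫ mulGen A =
      lift ((⟨[A]⟩ : DistPresented E) ◁ fst _ _ ≫ mulGen A)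
        ((⟨[A]⟩ : DistPresented E) ◁ snd _ _ ≫ mulGen A) ≫ Presented.addGen A := by
  have h : (⟨[A]⟩ : DistPresented E) ◁ Presented.addGen A ≫ mulGen A =
      (Presented.copyGen A ⊗ₘ 𝟙 (⟨[A]⟩ ⊗ ⟨[A]⟩)) ≫ tensorμ (⟨[A]⟩ : DistPresented E) ⟨[A]⟩ ⟨[A]⟩ ⟨[A]⟩ ≫
        (mulGen A ⊗ₘ mulGen A) ≫ Presented.addGen A := by
    rw [Presented.tensorμ_eq]
    simp only [Category.assoc]
    exact Presented.ofTerm_sound (.eqn (.mul_add A))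
  have hc : Presented.copyGen A = copyHom (⟨[A]⟩ : DistPresented E) :=
    (Presented.copy_singleton A).symm
  rw [h, hc, ← Category.assoc, copy_tensorμ, ← Category.assoc, lift_map]

theorem mulGen_zero (A : O) :
    (⟨[A]⟩ : DistPresented E) ◁ Presented.zeroGen A ≫ mulGen A =
      toUnit _ ≫ Presented.zeroGen A := by
  have h : (⟨[A]⟩ : DistPresented E) ◁ Presented.zeroGen A ≫ mulGen A =
      Presented.eqHom (List.append_nil [A]) ≫ Presented.discardGen A ≫ Presented.zeroGen A :=
    Presented.ofTerm_sound (.eqn (.mul_zero A))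
  rw [h, ← Category.assoc]
  congr 1
  exact toUnit_unique (C := DistPresented E) _ _

instance : CartesianDistributive (DistPresented E) where
  mul X := Presented.mulWord mulGen X.word
  one X := Presented.oneWord oneGen X.word
  mul_comm X := Presented.mulWord_comm (fun A => Presented.ofTerm_sound (.eqn (.mul_comm A))) X.word
  mul_assoc X :=
    Presented.mulWord_assoc (fun A => Presented.ofTerm_sound (.eqn (.mul_assoc A))) X.word
  one_mul X := Presented.mulWord_unit (fun A => Presented.ofTerm_sound (.eqn (.one_mul A))) X.word
  mul_add X := Presented.mulWord_distrib mulGen_add X.word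
  mul_zero X := Presented.mulWord_annih mulGen_zero X.word
  mul_tensor X Y := Presented.mulWord_append X.word Y.word
  one_tensor X Y := Presented.oneWord_append X.word Y.word

theorem mul_singleton (A : O) :
    CartesianDistributive.mul (⟨[A]⟩ : DistPresented E) = Presented.ofTerm (Term.mul A) :=
  Presented.mulWord_singleton A

theorem one_singleton (A : O) :
    CartesianDistributive.one (⟨[A]⟩ : DistPresented E) = Presented.ofTerm (Term.one A) :=
  Presented.oneWord_singleton A

end DistPresented

end Distributive

end RevDiff

/-! The structural axioms say that `f ↦ (f, R f)` sends morphisms to lenses, compatibly with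
composition and products. On a presented category such an `R` is therefore determined by its values
on generators (`IsStructural.eq_of_gen`), which gives uniqueness; the value at a unit is forced
because its codomain is terminal.

For existence, values on generators extend to all terms by composing and tensoring lenses
(`reverseTerm`), and the question is whether the result descends to the quotient. By
`reverseTerm_rel` the axioms of cartesian left-additive categories take care of themselves, provided
that the backward parts are additive in the change; this additivity is what naturality of copying
and discarding amounts to. Two kinds of equations remain for `𝒞*`. The laws of multiplication become
polynomial identities in the hom-semirings. The equations `E` are arbitrary, but on an included term
the recursion returns the image of `R` (`reverseTerm_incl`), and `R` is already defined on classes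
of terms. Faithfulness of `ι` is never needed.

Linearity of change and symmetry of partial derivatives are properties of single morphisms, so once
the combinator exists they can be proved by induction on a representing term, with no further
compatibility with the relations to check. The property `IsSmooth` that combines them is closed
under composition, pairing, sums and products, by the forward chain rule `forward_comp` and the
Leibniz rule `forward_homMul`. For generators coming from `𝒞` it is an equation transported along
`ι`, and the multiplication is the product of two projections. -/

namespace RevDiff

/-! ### Generalized elements of products. -/

section Elements

variable {C : Type u} [Category.{v} C] [CartesianMonoidalCategory C]

/-- The two projections form the generic element: their pairing is the identity. This licenses all
later computations with `lift x y`. -/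
theorem hom_ext_elements {X Y Z : C} {f g : X ⊗ Y ⟶ Z}
    (h : ∀ (T : C) (x : T ⟶ X) (y : T ⟶ Y), lift x y ≫ f = lift x y ≫ g) : f = g := by
  simpa using h _ (fst X Y) (snd X Y)

theorem exists_lift {T X Y : C} (f : T ⟶ X ⊗ Y) : ∃ a b, f = lift a b :=
  ⟨f ≫ fst X Y, f ≫ snd X Y, by simp⟩

@[simp]
theorem lift_tensorμ [BraidedCategory C] {T X Y Z W : C} (a : T ⟶ X) (b : T ⟶ Y) (c : T ⟶ Z)
    (d : T ⟶ W) :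
    lift (lift a b) (lift c d) ≫ tensorμ X Y Z W = lift (lift a c) (lift b d) := by
  ext <;> simp

@[simp]
theorem lift_tensorμ_assoc [BraidedCategory C] {T X Y Z W : C} (a : T ⟶ X) (b : T ⟶ Y) (c : T ⟶ Z)
    (d : T ⟶ W) {V : C} (m : _ ⟶ V) :
    lift (lift a b) (lift c d) ≫ tensorμ X Y Z W ≫ m = (lift (lift a c) (lift b d)) ≫ m := by
  simp only [← Category.assoc, lift_tensorμ]

@[simp]
theorem comp_copyHom {X Y : C} (f : X ⟶ Y) : f ≫ copyHom Y = lift f f := by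
  simp [copyHom]

@[simp]
theorem comp_leftUnitor_inv {X Y : C} (f : X ⟶ Y) : f ≫ (λ_ Y).inv = lift (toUnit X) f := by
  ext; simp

@[simp]
theorem comp_leftUnitor_inv_assoc {X Y : C} (f : X ⟶ Y) {V : C} (m : _ ⟶ V) :
    f ≫ (λ_ Y).inv ≫ m = (lift (toUnit X) f) ≫ m := by
  simp only [← Category.assoc, comp_leftUnitor_inv]

@[simp]
theorem comp_rightUnitor_inv {X Y : C} (f : X ⟶ Y) : f ≫ (ρ_ Y).inv = lift f (toUnit X) := by
  ext; simp

end Elements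

/-! ### Hom-sets as commutative monoids. -/

section Additive

variable {C : Type u} [Category.{v} C] [CartesianMonoidalCategory C] [BraidedCategory C]
  [CartesianLeftAdditive C]

open CartesianLeftAdditive

theorem comp_zero_eq {T X : C} (f : T ⟶ 𝟙_ C) : f ≫ zero X = zeroHom T X := by
  rw [zeroHom, toUnit_unique f (toUnit T)]

instance homAdd (T X : C) : Add (T ⟶ X) := ⟨fun f g => lift f g ≫ add X⟩

instance homZero (T X : C) : Zero (T ⟶ X) := ⟨zeroHom T X⟩

/-- Pointwise addition of morphisms. -/
instance homAddCommMonoid (T X : C) : AddCommMonoid (T ⟶ X) where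
  nsmul := nsmulRec
  add_comm f g := by
    change lift f g ≫ add X = lift g f ≫ add X
    conv_lhs => rw [← CartesianLeftAdditive.add_comm X]
    simp
  add_assoc f g h := by
    change lift (lift f g ≫ add X) h ≫ add X = lift f (lift g h ≫ add X) ≫ add X
    have := congrArg (fun k => lift (lift f g) h ≫ k) (CartesianLeftAdditive.add_assoc X)
    simpa using this
  zero_add f := by
    change lift (zeroHom T X) f ≫ add X = f
    have := congrArg (fun k => lift (toUnit T) f ≫ k) (CartesianLeftAdditive.zero_add X)
    simpa [zeroHom] using this
  add_zero f := by
    change lift f (zeroHom T X) ≫ add X = f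
    rw [← CartesianLeftAdditive.add_comm X]
    have := congrArg (fun k => lift (toUnit T) f ≫ k) (CartesianLeftAdditive.zero_add X)
    simpa [zeroHom] using this

@[simp]
theorem lift_comp_add {T X : C} (f g : T ⟶ X) : lift f g ≫ add X = f + g := rfl

theorem comp_add_eq {T X : C} (f : T ⟶ X ⊗ X) : f ≫ add X = f ≫ fst X X + f ≫ snd X X := by
  rw [← lift_comp_add, lift_comp_fst_snd]

@[simp]
theorem add_eq_fst_add_snd (X : C) : add X = fst X X + snd X X := by
  simpa using comp_add_eq (𝟙 (X ⊗ X))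

@[simp]
theorem zeroHom_eq (X Y : C) : zeroHom X Y = 0 := rfl

@[simp]
theorem zero_eq (X : C) : zero X = 0 := by
  rw [← zeroHom_eq, ← comp_zero_eq (𝟙 _), Category.id_comp]

@[simp]
-- Addition of morphisms is postcomposition with `add X`, so precomposition respects it.
-- Postcomposition need not, since the monoid maps are not assumed natural.
theorem comp_homAdd {S T X : C} (k : S ⟶ T) (f g : T ⟶ X) : k ≫ (f + g) = k ≫ f + k ≫ g := by
  rw [← lift_comp_add, ← lift_comp_add, ← Category.assoc, comp_lift]

@[simp]
theorem comp_homZero {S T X : C} (k : S ⟶ T) : k ≫ (0 : T ⟶ X) = 0 := by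
  rw [← zeroHom_eq, zeroHom, ← Category.assoc, comp_toUnit]
  rfl

@[simp]
-- This is the componentwise definition of addition on a product, read on elements; the interchange
-- `tensorμ` regroups the four components.
theorem lift_add_lift {T X Y : C} (a c : T ⟶ X) (b d : T ⟶ Y) :
    lift a b + lift c d = lift (a + c) (b + d) := by
  rw [← lift_comp_add, add_tensor, lift_tensorμ_assoc, lift_map]
  rfl

@[simp]
theorem lift_zero_zero (T X Y : C) : lift (0 : T ⟶ X) (0 : T ⟶ Y) = 0 := by
  have h : (0 : T ⟶ X ⊗ Y) = toUnit T ≫ zero (X ⊗ Y) := rfl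
  rw [h, zero_tensor]
  simp

@[simp]
theorem homAdd_snd {T X Y : C} (f g : T ⟶ X ⊗ Y) :
    (f + g) ≫ snd X Y = f ≫ snd X Y + g ≫ snd X Y := by
  obtain ⟨a, b, rfl⟩ := exists_lift f
  obtain ⟨c, d, rfl⟩ := exists_lift g
  simp

@[simp]
theorem homZero_fst (T X Y : C) : (0 : T ⟶ X ⊗ Y) ≫ fst X Y = 0 := by
  rw [← lift_zero_zero, lift_fst]

@[simp]
theorem homZero_snd (T X Y : C) : (0 : T ⟶ X ⊗ Y) ≫ snd X Y = 0 := by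
  rw [← lift_zero_zero, lift_snd]

end Additive

/-! ### Hom-sets as commutative semirings. -/

section Multiplicative

variable {C : Type u} [Category.{v} C] [CartesianMonoidalCategory C] [BraidedCategory C]
  [CartesianDistributive C]

open CartesianDistributive

/-- Pointwise operations on morphisms. -/
instance homCommSemiring (T X : C) : CommSemiring (T ⟶ X) where
  __ := homAddCommMonoid T X
  mul f g := lift f g ≫ mul X
  one := toUnit T ≫ one X
  mul_comm f g := by
    change lift f g ≫ mul X = lift g f ≫ mul X
    conv_lhs => rw [← CartesianDistributive.mul_comm X]
    simp
  mul_assoc f g h := by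
    change lift (lift f g ≫ mul X) h ≫ mul X = lift f (lift g h ≫ mul X) ≫ mul X
    have := congrArg (fun k => lift (lift f g) h ≫ k) (CartesianDistributive.mul_assoc X)
    simpa using this
  one_mul f := by
    change lift (toUnit T ≫ one X) f ≫ mul X = f
    have := congrArg (fun k => lift (toUnit T) f ≫ k) (CartesianDistributive.one_mul X)
    simpa using this
  mul_one f := by
    change lift f (toUnit T ≫ one X) ≫ mul X = f
    rw [← CartesianDistributive.mul_comm X]
    have := congrArg (fun k => lift (toUnit T) f ≫ k) (CartesianDistributive.one_mul X)
    simpa using this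
  left_distrib f g h := by
    change lift f (g + h) ≫ mul X = lift f g ≫ mul X + lift f h ≫ mul X
    have := congrArg (fun k => lift f (lift g h) ≫ k) (CartesianDistributive.mul_add X)
    simpa using this
  right_distrib f g h := by
    change lift (f + g) h ≫ mul X = lift f h ≫ mul X + lift g h ≫ mul X
    rw [← CartesianDistributive.mul_comm X]
    have := congrArg (fun k => lift h (lift f g) ≫ k) (CartesianDistributive.mul_add X)
    simpa using this
  zero_mul f := by
    change lift 0 f ≫ mul X = 0
    rw [← CartesianDistributive.mul_comm X]
    have := congrArg (fun k => lift f (toUnit T) ≫ k) (CartesianDistributive.mul_zero X)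
    simpa using this
  mul_zero f := by
    change lift f 0 ≫ mul X = 0
    have := congrArg (fun k => lift f (toUnit T) ≫ k) (CartesianDistributive.mul_zero X)
    simpa using this

@[simp]
theorem lift_comp_mul {T X : C} (f g : T ⟶ X) : lift f g ≫ mul X = f * g := rfl

@[simp]
theorem mul_eq_fst_mul_snd (X : C) : mul X = fst X X * snd X X := by
  rw [← lift_comp_mul, lift_fst_snd, Category.id_comp]

@[simp]
theorem comp_one_eq {T X : C} (f : T ⟶ 𝟙_ C) : f ≫ one X = 1 := by
  rw [toUnit_unique f (toUnit T)]; rfl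

@[simp]
theorem one_eq (X : C) : one X = 1 := by
  rw [← comp_one_eq (𝟙 (𝟙_ C)), Category.id_comp]

@[simp]
theorem comp_homMul {S T X : C} (k : S ⟶ T) (f g : T ⟶ X) : k ≫ (f * g) = (k ≫ f) * (k ≫ g) := by
  rw [← lift_comp_mul, ← lift_comp_mul, ← Category.assoc, comp_lift]

@[simp]
theorem comp_homOne {S T X : C} (k : S ⟶ T) : k ≫ (1 : T ⟶ X) = 1 := by
  rw [← comp_one_eq (toUnit T), ← Category.assoc, comp_one_eq]

@[simp]
theorem lift_mul_lift {T X Y : C} (a c : T ⟶ X) (b d : T ⟶ Y) :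
    lift a b * lift c d = lift (a * c) (b * d) := by
  rw [← lift_comp_mul, mul_tensor, lift_tensorμ_assoc, lift_map]
  rfl

end Multiplicative

/-! ### Lenses: composition, product and symmetric monoidal laws of backward parts. -/

section Lens

variable {C : Type u} [Category.{v} C] [CartesianMonoidalCategory C]

/-- The backward part of a composite of lenses, with forward part `f` of the first one. -/
def lensComp {X Y Z : C} (f : X ⟶ Y) (rf : X ⊗ Y ⟶ X) (rg : Y ⊗ Z ⟶ Y) : X ⊗ Z ⟶ X :=
  lift (fst X Z) (lift (fst X Z ≫ f) (snd X Z) ≫ rg) ≫ rf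

@[simp]
-- The reverse chain rule on elements. Together with `lift_lensTensor` it reduces each law of lenses
-- below to an evaluation at generic elements.
theorem lift_lensComp {T X Y Z : C} (f : X ⟶ Y) (rf : X ⊗ Y ⟶ X) (rg : Y ⊗ Z ⟶ Y) (x : T ⟶ X)
    (z : T ⟶ Z) :
    lift x z ≫ lensComp f rf rg = lift x (lift (x ≫ f) z ≫ rg) ≫ rf := by
  simp [lensComp, ← Category.assoc]

theorem lensComp_eq {X Y Z : C} (f : X ⟶ Y) (rf : X ⊗ Y ⟶ X) (rg : Y ⊗ Z ⟶ Y) :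
    lensComp f rf rg = lift (fst X Z) (lift (fst X Z ≫ f) (snd X Z) ≫ rg) ≫ rf := rfl

attribute [irreducible] lensComp

theorem lensComp_id_left {X Y : C} (rf : X ⊗ Y ⟶ X) : lensComp (𝟙 X) (snd X X) rf = rf :=
  hom_ext_elements fun T x y => by simp

theorem lensComp_id_right {X Y : C} (f : X ⟶ Y) (rf : X ⊗ Y ⟶ X) :
    lensComp f rf (snd Y Y) = rf :=
  hom_ext_elements fun T x y => by simp

theorem lensComp_assoc {X Y Z W : C} (f : X ⟶ Y) (g : Y ⟶ Z) (rf : X ⊗ Y ⟶ X) (rg : Y ⊗ Z ⟶ Y)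
    (rk : Z ⊗ W ⟶ Z) :
    lensComp (f ≫ g) (lensComp f rf rg) rk = lensComp f rf (lensComp g rg rk) :=
  hom_ext_elements fun T x y => by simp

/-- When the backward parts ignore the base point, the chain rule is plain composition in the
opposite order. All structural maps other than discard and zero are handled in this form. -/
theorem lensComp_linear {X Y Z : C} (f : X ⟶ Y) (f' : Y ⟶ X) (g' : Z ⟶ Y) :
    lensComp f (snd X Y ≫ f') (snd Y Z ≫ g') = snd X Z ≫ g' ≫ f' :=
  hom_ext_elements fun T x y => by simp

variable [BraidedCategory C]

/-- The backward part of a product of lenses. -/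
def lensTensor {X Y X' Y' : C} (rf : X ⊗ Y ⟶ X) (rg : X' ⊗ Y' ⟶ X') :
    (X ⊗ X') ⊗ (Y ⊗ Y') ⟶ X ⊗ X' :=
  tensorμ X X' Y Y' ≫ (rf ⊗ₘ rg)

@[simp]
theorem lift_lensTensor {T X Y X' Y' : C} (rf : X ⊗ Y ⟶ X) (rg : X' ⊗ Y' ⟶ X') (x : T ⟶ X)
    (x' : T ⟶ X') (y : T ⟶ Y) (y' : T ⟶ Y') :
    lift (lift x x') (lift y y') ≫ lensTensor rf rg = lift (lift x y ≫ rf) (lift x' y' ≫ rg) := by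
  simp [lensTensor]

theorem lensTensor_eq {X Y X' Y' : C} (rf : X ⊗ Y ⟶ X) (rg : X' ⊗ Y' ⟶ X') :
    lensTensor rf rg = tensorμ X X' Y Y' ≫ (rf ⊗ₘ rg) := rfl

attribute [irreducible] lensTensor

theorem lensTensor_linear {X Y X' Y' : C} (f' : Y ⟶ X) (g' : Y' ⟶ X') :
    lensTensor (snd X Y ≫ f') (snd X' Y' ≫ g') = snd (X ⊗ X') (Y ⊗ Y') ≫ (f' ⊗ₘ g') :=
  hom_ext_elements fun T x y => by
    obtain ⟨x, x', rfl⟩ := exists_lift x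
    obtain ⟨y, y', rfl⟩ := exists_lift y
    simp

theorem lensTensor_id (X Y : C) : lensTensor (snd X X) (snd Y Y) = snd (X ⊗ Y) (X ⊗ Y) := by
  simpa using lensTensor_linear (𝟙 X) (𝟙 Y)

theorem lensTensor_lensComp {X Y Z X' Y' Z' : C} (f : X ⟶ Y) (f' : X' ⟶ Y') (rf : X ⊗ Y ⟶ X)
    (rg : Y ⊗ Z ⟶ Y) (rf' : X' ⊗ Y' ⟶ X') (rg' : Y' ⊗ Z' ⟶ Y') :
    lensTensor (lensComp f rf rg) (lensComp f' rf' rg') =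
      lensComp (f ⊗ₘ f') (lensTensor rf rf') (lensTensor rg rg') :=
  hom_ext_elements fun T x z => by
    obtain ⟨x, x', rfl⟩ := exists_lift x
    obtain ⟨z, z', rfl⟩ := exists_lift z
    simp

theorem lensTensor_assoc {X Y X' Y' X'' Y'' : C} (f : X ⟶ Y) (f' : X' ⟶ Y') (f'' : X'' ⟶ Y'')
    (rf : X ⊗ Y ⟶ X) (rf' : X' ⊗ Y' ⟶ X') (rf'' : X'' ⊗ Y'' ⟶ X'') :
    lensComp ((f ⊗ₘ f') ⊗ₘ f'') (lensTensor (lensTensor rf rf') rf'')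
        (snd ((Y ⊗ Y') ⊗ Y'') (Y ⊗ (Y' ⊗ Y'')) ≫ (α_ Y Y' Y'').inv) =
      lensComp (α_ X X' X'').hom (snd ((X ⊗ X') ⊗ X'') (X ⊗ (X' ⊗ X'')) ≫ (α_ X X' X'').inv)
        (lensTensor rf (lensTensor rf' rf'')) :=
  hom_ext_elements fun T x y => by
    obtain ⟨x, x'', rfl⟩ := exists_lift x
    obtain ⟨x, x', rfl⟩ := exists_lift x
    obtain ⟨y, y', rfl⟩ := exists_lift y
    obtain ⟨y', y'', rfl⟩ := exists_lift y'
    simp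

theorem lensTensor_leftUnit {X Y : C} (f : X ⟶ Y) (rf : X ⊗ Y ⟶ X) :
    lensComp (𝟙 (𝟙_ C) ⊗ₘ f) (lensTensor (snd (𝟙_ C) (𝟙_ C)) rf)
        (snd (𝟙_ C ⊗ Y) Y ≫ (λ_ Y).inv) =
      lensComp (λ_ X).hom (snd (𝟙_ C ⊗ X) X ≫ (λ_ X).inv) rf :=
  hom_ext_elements fun T x y => by
    obtain ⟨t, x, rfl⟩ := exists_lift x
    simp

theorem lensTensor_rightUnit {X Y : C} (f : X ⟶ Y) (rf : X ⊗ Y ⟶ X) :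
    lensComp (f ⊗ₘ 𝟙 (𝟙_ C)) (lensTensor rf (snd (𝟙_ C) (𝟙_ C)))
        (snd (Y ⊗ 𝟙_ C) Y ≫ (ρ_ Y).inv) =
      lensComp (ρ_ X).hom (snd (X ⊗ 𝟙_ C) X ≫ (ρ_ X).inv) rf :=
  hom_ext_elements fun T x y => by
    obtain ⟨x, t, rfl⟩ := exists_lift x
    simp

theorem lensTensor_braiding {X Y X' Y' : C} (f : X ⟶ Y) (g : X' ⟶ Y') (rf : X ⊗ Y ⟶ X)
    (rg : X' ⊗ Y' ⟶ X') :
    lensComp (f ⊗ₘ g) (lensTensor rf rg) (snd (Y ⊗ Y') (Y' ⊗ Y) ≫ (β_ Y' Y).hom) =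
      lensComp (β_ X X').hom (snd (X ⊗ X') (X' ⊗ X) ≫ (β_ X' X).hom) (lensTensor rg rf) :=
  hom_ext_elements fun T x y => by
    obtain ⟨x, x', rfl⟩ := exists_lift x
    obtain ⟨y, y', rfl⟩ := exists_lift y
    simp

theorem lensComp_braiding_braiding (X Y : C) :
    lensComp (β_ X Y).hom (snd (X ⊗ Y) (Y ⊗ X) ≫ (β_ Y X).hom)
        (snd (Y ⊗ X) (X ⊗ Y) ≫ (β_ X Y).hom) = snd (X ⊗ Y) (X ⊗ Y) :=
  hom_ext_elements fun T x y => by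
    obtain ⟨y, y', rfl⟩ := exists_lift y
    simp

theorem lensComp_hexagon (X Y Z : C) :
    lensComp (α_ X Y Z).hom (snd _ _ ≫ (α_ X Y Z).inv)
        (lensComp (β_ X (Y ⊗ Z)).hom (snd _ _ ≫ (β_ (Y ⊗ Z) X).hom)
          (snd _ _ ≫ (α_ Y Z X).inv)) =
      lensComp ((β_ X Y).hom ⊗ₘ 𝟙 Z) (lensTensor (snd _ _ ≫ (β_ Y X).hom) (snd Z Z))
        (lensComp (α_ Y X Z).hom (snd _ _ ≫ (α_ Y X Z).inv)
          (lensTensor (snd Y Y) (snd _ _ ≫ (β_ Z X).hom))) :=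
  hom_ext_elements fun T x y => by
    obtain ⟨y, y', rfl⟩ := exists_lift y
    obtain ⟨y', y'', rfl⟩ := exists_lift y'
    obtain ⟨x, x'', rfl⟩ := exists_lift x
    obtain ⟨x, x', rfl⟩ := exists_lift x
    simp

theorem lensComp_braiding_add (X : C) :
    lensComp (β_ X X).hom (snd (X ⊗ X) (X ⊗ X) ≫ (β_ X X).hom) (snd (X ⊗ X) X ≫ copyHom X) =
      snd (X ⊗ X) X ≫ copyHom X :=
  hom_ext_elements fun T x y => by simp

/-- Addition on a product is the interchange followed by the two additions. Backwards, `(d, d')` is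
copied in each component and the inverse interchange regroups the copies into two copies of the
pair. -/
theorem lensComp_tensorμ_add (X Y : C) :
    lensComp (tensorμ X Y X Y) (snd ((X ⊗ Y) ⊗ (X ⊗ Y)) ((X ⊗ X) ⊗ (Y ⊗ Y)) ≫ tensorμ X X Y Y)
        (lensTensor (snd (X ⊗ X) X ≫ copyHom X) (snd (Y ⊗ Y) Y ≫ copyHom Y)) =
      snd ((X ⊗ Y) ⊗ (X ⊗ Y)) (X ⊗ Y) ≫ copyHom (X ⊗ Y) :=
  hom_ext_elements fun T x d => by
    obtain ⟨x, y, rfl⟩ := exists_lift x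
    obtain ⟨x, x', rfl⟩ := exists_lift x
    obtain ⟨y, y', rfl⟩ := exists_lift y
    obtain ⟨d, d', rfl⟩ := exists_lift d
    simp

end Lens

/-! ### Copying, addition and additivity of change for lenses. -/

section AdditiveLens

variable {C : Type u} [Category.{v} C] [CartesianMonoidalCategory C] [BraidedCategory C]
  [CartesianLeftAdditive C]

open CartesianLeftAdditive

/-- The backward part of copying is addition and vice versa. The comonoid laws of copying thus
become the monoid laws of addition here and in the next two lemmas, and the laws of addition become
those of copying. -/
theorem lensComp_copy_braiding (X : C) :
    lensComp (copyHom X) (snd X (X ⊗ X) ≫ add X) (snd (X ⊗ X) (X ⊗ X) ≫ (β_ X X).hom) =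
      snd X (X ⊗ X) ≫ add X := by
  rw [lensComp_linear, CartesianLeftAdditive.add_comm]

theorem lensComp_copy_assoc (X : C) :
    lensComp (copyHom X) (snd X (X ⊗ X) ≫ add X)
        (lensComp (copyHom X ⊗ₘ 𝟙 X) (lensTensor (snd X (X ⊗ X) ≫ add X) (snd X X))
          (snd _ _ ≫ (α_ X X X).inv)) =
      lensComp (copyHom X) (snd X (X ⊗ X) ≫ add X)
        (lensTensor (snd X X) (snd X (X ⊗ X) ≫ add X)) :=
  hom_ext_elements fun T x y => by
    obtain ⟨y, y', rfl⟩ := exists_lift y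
    obtain ⟨y', y'', rfl⟩ := exists_lift y'
    simp [_root_.add_assoc]

theorem lensComp_copy_counit (X : C) :
    lensComp (copyHom X) (snd X (X ⊗ X) ≫ add X)
        (lensComp (toUnit X ⊗ₘ 𝟙 X) (lensTensor (zeroHom (X ⊗ 𝟙_ C) X) (snd X X))
          (snd _ _ ≫ (λ_ X).inv)) = snd X X :=
  hom_ext_elements fun T x y => by simp

theorem lensComp_add_assoc (X : C) :
    lensComp (add X ⊗ₘ 𝟙 X) (lensTensor (snd (X ⊗ X) X ≫ copyHom X) (snd X X))
        (snd (X ⊗ X) X ≫ copyHom X) =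
      lensComp (α_ X X X).hom (snd _ _ ≫ (α_ X X X).inv)
        (lensComp (𝟙 X ⊗ₘ add X) (lensTensor (snd X X) (snd (X ⊗ X) X ≫ copyHom X))
          (snd (X ⊗ X) X ≫ copyHom X)) :=
  hom_ext_elements fun T x y => by
    obtain ⟨x, x'', rfl⟩ := exists_lift x
    obtain ⟨x, x', rfl⟩ := exists_lift x
    simp

theorem lensComp_zero_add (X : C) :
    lensComp (zero X ⊗ₘ 𝟙 X) (lensTensor (toUnit (𝟙_ C ⊗ X)) (snd X X))
        (snd (X ⊗ X) X ≫ copyHom X) = snd _ _ ≫ (λ_ X).inv :=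
  hom_ext_elements fun T x y => by
    obtain ⟨x, x', rfl⟩ := exists_lift x
    simp

/-- The backward part of a lens is additive in the change. -/
structure AdditiveChange {X Y : C} (r : X ⊗ Y ⟶ X) : Prop where
  lift_add {T : C} (x : T ⟶ X) (a b : T ⟶ Y) : lift x (a + b) ≫ r = lift x a ≫ r + lift x b ≫ r
  lift_zero {T : C} (x : T ⟶ X) : lift x (0 : T ⟶ Y) ≫ r = 0

/-- The elementwise form serves calculation; the form with equations between morphisms is the one
that a functor can transport. -/
theorem additiveChange_iff {X Y : C} {r : X ⊗ Y ⟶ X} :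
    AdditiveChange r ↔
      X ◁ add Y ≫ r = lift (X ◁ fst Y Y ≫ r) (X ◁ snd Y Y ≫ r) ≫ add X ∧
        X ◁ zero Y ≫ r = zeroHom (X ⊗ 𝟙_ C) X := by
  constructor
  · rintro ⟨h, h'⟩
    constructor
    · refine hom_ext_elements fun T x y => ?_
      obtain ⟨a, b, rfl⟩ := exists_lift y
      simpa using h x a b
    · refine hom_ext_elements fun T x y => ?_
      simpa using h' x
  · rintro ⟨h, h'⟩
    constructor
    · intro T x a b
      simpa using congrArg (fun k => lift x (lift a b) ≫ k) h
    · intro T x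
      simpa using congrArg (fun k => lift x (toUnit T) ≫ k) h'

namespace AdditiveChange

theorem lensComp {X Y Z : C} {f : X ⟶ Y} {rf : X ⊗ Y ⟶ X} {rg : Y ⊗ Z ⟶ Y}
    (hf : AdditiveChange rf) (hg : AdditiveChange rg) : AdditiveChange (lensComp f rf rg) where
  lift_add x a b := by simp [hf.lift_add, hg.lift_add]
  lift_zero x := by simp [hf.lift_zero, hg.lift_zero]

theorem lensTensor {X Y X' Y' : C} {rf : X ⊗ Y ⟶ X} {rg : X' ⊗ Y' ⟶ X'}
    (hf : AdditiveChange rf) (hg : AdditiveChange rg) : AdditiveChange (lensTensor rf rg) where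
  lift_add x a b := by
    obtain ⟨x, x', rfl⟩ := exists_lift x
    obtain ⟨a, a', rfl⟩ := exists_lift a
    obtain ⟨b, b', rfl⟩ := exists_lift b
    simp [hf.lift_add, hg.lift_add]
  lift_zero x := by
    obtain ⟨x, x', rfl⟩ := exists_lift x
    rw [← lift_zero_zero, lift_lensTensor, hf.lift_zero, hg.lift_zero, lift_zero_zero]

/-- A map that preserves addition and zero, as the backward part of a lens. -/
theorem of_additive {X Y : C} {g : Y ⟶ X}
    (h : ∀ (T : C) (a b : T ⟶ Y), (a + b) ≫ g = a ≫ g + b ≫ g)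
    (h' : ∀ T : C, (0 : T ⟶ Y) ≫ g = 0) : AdditiveChange (snd X Y ≫ g) where
  lift_add x a b := by simpa using h _ a b
  lift_zero x := by simpa using h' _

end AdditiveChange

theorem lensTensor_discard (X Y : C) :
    lensComp (toUnit X ⊗ₘ toUnit Y)
        (lensTensor (zeroHom (X ⊗ 𝟙_ C) X) (zeroHom (Y ⊗ 𝟙_ C) Y))
        (snd (𝟙_ C ⊗ 𝟙_ C) (𝟙_ C) ≫ (λ_ (𝟙_ C)).inv) =
      zeroHom ((X ⊗ Y) ⊗ 𝟙_ C) (X ⊗ Y) :=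
  hom_ext_elements fun T x y => by
    obtain ⟨x, x', rfl⟩ := exists_lift x
    simp

theorem additiveChange_braiding (X Y : C) :
    AdditiveChange (snd (X ⊗ Y) (Y ⊗ X) ≫ (β_ Y X).hom) := by
  refine .of_additive (fun T a b => ?_) fun T => ?_
  · obtain ⟨a, a', rfl⟩ := exists_lift a
    obtain ⟨b, b', rfl⟩ := exists_lift b
    simp
  · rw [← lift_zero_zero, lift_braiding_hom, lift_zero_zero]

theorem additiveChange_snd (X : C) : AdditiveChange (snd X X) := ⟨by simp, by simp⟩

/-- Addition is itself additive because it is commutative and associative. -/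
theorem additiveChange_copy (X : C) : AdditiveChange (snd X (X ⊗ X) ≫ add X) := by
  refine .of_additive (fun T a b => ?_) fun T => ?_
  · obtain ⟨a, a', rfl⟩ := exists_lift a
    obtain ⟨b, b', rfl⟩ := exists_lift b
    simpa using add_add_add_comm a b a' b'
  · simp

theorem additiveChange_add (X : C) : AdditiveChange (snd (X ⊗ X) X ≫ copyHom X) :=
  .of_additive (by simp) (by simp)

theorem additiveChange_zeroHom (X Y : C) : AdditiveChange (zeroHom (X ⊗ Y) X) :=
  ⟨by simp, by simp⟩

theorem additiveChange_toUnit (X : C) : AdditiveChange (toUnit (𝟙_ C ⊗ X)) :=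
  ⟨fun _ _ _ => toUnit_unique _ _, fun _ => toUnit_unique _ _⟩

/-- Evaluated at `(x, (a, b))`, the sides are `r (x, a + b)` and `r (x, a) + r (x, b)`. Naturality
of copying is thus exactly additivity in the change; naturality of discarding, below, is
preservation of zero. -/
theorem lensComp_copy_natural {X Y : C} (f : X ⟶ Y) {r : X ⊗ Y ⟶ X} (h : AdditiveChange r) :
    lensComp f r (snd Y (Y ⊗ Y) ≫ add Y) =
      lensComp (copyHom X) (snd X (X ⊗ X) ≫ add X) (lensTensor r r) :=
  hom_ext_elements fun T x y => by
    obtain ⟨a, b, rfl⟩ := exists_lift y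
    simp [h.lift_add]

theorem lensComp_discard_natural {X Y : C} (f : X ⟶ Y) {r : X ⊗ Y ⟶ X} (h : AdditiveChange r) :
    lensComp f r (zeroHom (Y ⊗ 𝟙_ C) Y) = zeroHom (X ⊗ 𝟙_ C) X :=
  hom_ext_elements fun T x y => by simp [h.lift_zero]

end AdditiveLens

/-! ### The laws of multiplication for lenses. -/

section MultiplicativeLens

variable {C : Type u} [Category.{v} C] [CartesianMonoidalCategory C] [BraidedCategory C]
  [CartesianDistributive C]

open CartesianDistributive CartesianLeftAdditive

/-- The reverse derivative of the multiplication. -/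
def mulReverse (X : C) : (X ⊗ X) ⊗ X ⟶ X ⊗ X :=
  lift (lift (fst (X ⊗ X) X ≫ snd X X) (snd (X ⊗ X) X) ≫ mul X)
    (lift (fst (X ⊗ X) X ≫ fst X X) (snd (X ⊗ X) X) ≫ mul X)

@[simp]
theorem lift_mulReverse {T X : C} (x y d : T ⟶ X) :
    lift (lift x y) d ≫ mulReverse X = lift (y * d) (x * d) := by
  simp [mulReverse]

theorem additiveChange_mulReverse (X : C) : AdditiveChange (mulReverse X) where
  lift_add x a b := by
    obtain ⟨x, x', rfl⟩ := exists_lift x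
    simp [_root_.mul_add]
  lift_zero x := by
    obtain ⟨x, x', rfl⟩ := exists_lift x
    simp

theorem lensComp_braiding_mul (X : C) :
    lensComp (β_ X X).hom (snd (X ⊗ X) (X ⊗ X) ≫ (β_ X X).hom) (mulReverse X) = mulReverse X :=
  hom_ext_elements fun T x y => by
    obtain ⟨x, x', rfl⟩ := exists_lift x
    simp

/-- Both sides send `((x, y, z), d)` to the products of `d` with the two remaining factors, namely
`yzd`, `xzd` and `xyd`. -/
theorem lensComp_mul_assoc (X : C) :
    lensComp (mul X ⊗ₘ 𝟙 X) (lensTensor (mulReverse X) (snd X X)) (mulReverse X) =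
      lensComp (α_ X X X).hom (snd _ _ ≫ (α_ X X X).inv)
        (lensComp (𝟙 X ⊗ₘ mul X) (lensTensor (snd X X) (mulReverse X)) (mulReverse X)) :=
  hom_ext_elements fun T x d => by
    obtain ⟨x, x'', rfl⟩ := exists_lift x
    obtain ⟨x, x', rfl⟩ := exists_lift x
    simp
    ring_nf

theorem lensComp_one_mul (X : C) :
    lensComp (one X ⊗ₘ 𝟙 X) (lensTensor (toUnit (𝟙_ C ⊗ X)) (snd X X)) (mulReverse X) =
      snd _ _ ≫ (λ_ X).inv :=
  hom_ext_elements fun T x y => by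
    obtain ⟨x, x', rfl⟩ := exists_lift x
    simp

/-- At `((x, (y, z)), d)` both sides give `((y + z)d, (xd, xd))`. On the right the first entry
arises as `yd + zd`, since the backward part of copying `x` is a sum. -/
theorem lensComp_mul_add (X : C) :
    lensComp (𝟙 X ⊗ₘ add X) (lensTensor (snd X X) (snd (X ⊗ X) X ≫ copyHom X)) (mulReverse X) =
      lensComp (copyHom X ⊗ₘ 𝟙 (X ⊗ X))
        (lensTensor (snd X (X ⊗ X) ≫ add X) (snd (X ⊗ X) (X ⊗ X)))
        (lensComp (tensorμ X X X X) (snd _ _ ≫ tensorμ X X X X)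
          (lensComp (mul X ⊗ₘ mul X) (lensTensor (mulReverse X) (mulReverse X))
            (snd (X ⊗ X) X ≫ copyHom X))) :=
  hom_ext_elements fun T x d => by
    obtain ⟨x, y, rfl⟩ := exists_lift x
    obtain ⟨y, z, rfl⟩ := exists_lift y
    simp
    ring_nf

/-- The change in the surviving variable is `0 · d` on the left and the zero from discarding on the
right. -/
theorem lensComp_mul_zero (X : C) :
    lensComp (𝟙 X ⊗ₘ zero X) (lensTensor (snd X X) (toUnit (𝟙_ C ⊗ X))) (mulReverse X) =
      lensComp (ρ_ X).hom (snd _ _ ≫ (ρ_ X).inv)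
        (lensComp (toUnit X) (zeroHom (X ⊗ 𝟙_ C) X) (toUnit (𝟙_ C ⊗ X))) :=
  hom_ext_elements fun T x d => by
    obtain ⟨x, y, rfl⟩ := exists_lift x
    simp

theorem lensComp_tensorμ_mul (X Y : C) :
    lensComp (tensorμ X Y X Y) (snd ((X ⊗ Y) ⊗ (X ⊗ Y)) ((X ⊗ X) ⊗ (Y ⊗ Y)) ≫ tensorμ X X Y Y)
        (lensTensor (mulReverse X) (mulReverse Y)) = mulReverse (X ⊗ Y) :=
  hom_ext_elements fun T x d => by
    obtain ⟨x, y, rfl⟩ := exists_lift x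
    obtain ⟨x, x', rfl⟩ := exists_lift x
    obtain ⟨y, y', rfl⟩ := exists_lift y
    obtain ⟨d, d', rfl⟩ := exists_lift d
    simp

end MultiplicativeLens

/-! ### Reverse derivatives of terms and their invariance under the axioms. -/

namespace Presented

variable {O : Type u} {S : List O → List O → Type v} {E : Equations S}

/-- Candidates for the reverse derivatives of the generating morphisms. -/
abbrev GenReverse (E : Equations S) :=
  ∀ ⦃w v : List O⦄, S w v → ((⟨w⟩ : Presented E) ⊗ ⟨v⟩ ⟶ (⟨w⟩ : Presented E))

/-- The reverse derivative of a term, given those of the generating morphisms. -/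
def reverseTerm (ρ : GenReverse E) :
    {w v : List O} → Term S w v → ((⟨w⟩ : Presented E) ⊗ ⟨v⟩ ⟶ (⟨w⟩ : Presented E))
  | _, _, .gen s => ρ s
  | _, _, .id w => snd (⟨w⟩ : Presented E) ⟨w⟩
  | _, _, .swap w v =>
    snd ((⟨w⟩ : Presented E) ⊗ ⟨v⟩) ((⟨v⟩ : Presented E) ⊗ ⟨w⟩) ≫ (β_ (⟨v⟩ : Presented E) ⟨w⟩).hom
  | _, _, .copy A =>
    snd (⟨[A]⟩ : Presented E) (⟨[A]⟩ ⊗ ⟨[A]⟩) ≫ CartesianLeftAdditive.add (⟨[A]⟩ : Presented E)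
  | _, _, .discard A => zeroHom ((⟨[A]⟩ : Presented E) ⊗ 𝟙_ (Presented E)) ⟨[A]⟩
  | _, _, .add A =>
    snd ((⟨[A]⟩ : Presented E) ⊗ ⟨[A]⟩) (⟨[A]⟩ : Presented E) ≫ copyHom (⟨[A]⟩ : Presented E)
  | _, _, .zero A => toUnit (𝟙_ (Presented E) ⊗ (⟨[A]⟩ : Presented E))
  | _, _, .comp f g => lensComp (ofTerm f) (reverseTerm ρ f) (reverseTerm ρ g)
  | _, _, .tensor f g => lensTensor (reverseTerm ρ f) (reverseTerm ρ g)

variable (ρ : GenReverse E)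

theorem reverseTerm_comp {w v x : List O} (f : Term S w v) (g : Term S v x) :
    reverseTerm ρ (f.comp g) = lensComp (ofTerm f) (reverseTerm ρ f) (reverseTerm ρ g) := rfl

/-- Regroups a right-nested composite so that its first three factors can be recognised as the
interchange of `reverseTerm_tensorμ`; needed for the distributive law. -/
theorem reverseTerm_comp_comp_comp {w v x y z : List O} (f : Term S w v) (g : Term S v x)
    (k : Term S x y) (l : Term S y z) :
    reverseTerm ρ (f.comp (g.comp (k.comp l))) =
      lensComp (ofTerm (f.comp (g.comp k))) (reverseTerm ρ (f.comp (g.comp k)))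
        (reverseTerm ρ l) := by
  simp only [reverseTerm_comp, ofTerm_comp, lensComp_assoc]

theorem reverseTerm_tensor {w v w' v' : List O} (f : Term S w v) (g : Term S w' v') :
    reverseTerm ρ (f.tensor g) = lensTensor (reverseTerm ρ f) (reverseTerm ρ g) := rfl

theorem reverseTerm_eqTo {w v : List O} (h : w = v) :
    reverseTerm ρ (Term.eqTo h) = snd (⟨w⟩ : Presented E) ⟨v⟩ ≫ eqHom h.symm := by
  subst h
  exact (Category.comp_id _).symm

theorem reverseTerm_id (w : List O) :
    reverseTerm ρ (Term.id w) = snd (⟨w⟩ : Presented E) ⟨w⟩ ≫ 𝟙 (⟨w⟩ : Presented E) :=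
  (Category.comp_id _).symm

/-- Every factor of the interchange has a backward part that ignores the base point, so the backward
part of the whole is the inverse: the interchange with its two middle words exchanged. -/
theorem reverseTerm_tensorμ (w w' v v' : List O)
    (h : (w ++ w') ++ (v ++ v') = w ++ ((w' ++ v) ++ v'))
    (h' : w ++ ((v ++ w') ++ v') = (w ++ v) ++ (w' ++ v')) :
    reverseTerm ρ ((Term.eqTo h).comp
      ((Term.tensor (Term.id w) (Term.tensor (Term.swap w' v) (Term.id v'))).comp
        (Term.eqTo h'))) =
      snd ((⟨w ++ w'⟩ : Presented E) ⊗ ⟨v ++ v'⟩) ((⟨w ++ v⟩ : Presented E) ⊗ ⟨w' ++ v'⟩) ≫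
        tensorμ (⟨w⟩ : Presented E) ⟨v⟩ ⟨w'⟩ ⟨v'⟩ := by
  have h₁ : reverseTerm ρ (Term.tensor (Term.swap w' v) (Term.id v')) =
      snd (⟨(w' ++ v) ++ v'⟩ : Presented E) (⟨(v ++ w') ++ v'⟩ : Presented E) ≫
        tens (ofTerm (Term.swap v w')) (𝟙 (⟨v'⟩ : Presented E)) := by
    rw [reverseTerm_tensor, reverseTerm_id]
    exact lensTensor_linear (C := Presented E) _ _
  have h₂ : reverseTerm ρ (Term.tensor (Term.id w) (Term.tensor (Term.swap w' v) (Term.id v'))) =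
      snd (⟨w ++ ((w' ++ v) ++ v')⟩ : Presented E) (⟨w ++ ((v ++ w') ++ v')⟩ : Presented E) ≫
        tens (𝟙 (⟨w⟩ : Presented E))
          (tens (ofTerm (Term.swap v w')) (𝟙 (⟨v'⟩ : Presented E))) := by
    rw [reverseTerm_tensor, h₁, reverseTerm_id]
    exact lensTensor_linear (C := Presented E) _ _
  rw [reverseTerm_comp, reverseTerm_comp, h₂, reverseTerm_eqTo, reverseTerm_eqTo,
    lensComp_linear, lensComp_linear, Category.assoc, tensorμ_eq]
  rfl

theorem reverseTerm_copyWord (w : List O) :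
    reverseTerm ρ (Term.copyWord w) =
      snd (⟨w⟩ : Presented E) (⟨w⟩ ⊗ ⟨w⟩) ≫ CartesianLeftAdditive.add (⟨w⟩ : Presented E) := by
  induction w with
  -- The empty word is the terminal object, so two maps into it agree.
  | nil => exact toUnit_unique (C := Presented E) _ _
  | cons A w ih =>
    have h₁ : reverseTerm ρ (Term.tensor (Term.copy A) (Term.copyWord w)) =
        snd ((⟨[A]⟩ : Presented E) ⊗ ⟨w⟩) (((⟨[A]⟩ : Presented E) ⊗ ⟨[A]⟩) ⊗ (⟨w⟩ ⊗ ⟨w⟩)) ≫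
          (CartesianLeftAdditive.add (⟨[A]⟩ : Presented E) ⊗ₘ
            CartesianLeftAdditive.add (⟨w⟩ : Presented E)) := by
      rw [reverseTerm_tensor, ih]
      exact lensTensor_linear (C := Presented E) _ _
    refine (reverseTerm_comp ρ (Term.tensor (Term.copy A) (Term.copyWord w)) _).trans ?_
    rw [h₁]
    refine (congrArg (lensComp _ _) (reverseTerm_tensorμ ρ [A] [A] w w _ _)).trans ?_
    refine (lensComp_linear (C := Presented E) _ _ _).trans ?_
    exact congrArg (fun k => _ ≫ k)
      (CartesianLeftAdditive.add_tensor (⟨[A]⟩ : Presented E) ⟨w⟩).symm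

theorem reverseTerm_discardWord (w : List O) :
    reverseTerm ρ (Term.discardWord w) =
      zeroHom ((⟨w⟩ : Presented E) ⊗ 𝟙_ (Presented E)) ⟨w⟩ := by
  induction w with
  | nil => exact toUnit_unique (C := Presented E) _ _
  | cons A w ih =>
    refine (congrArg (lensTensor _) ih).trans ?_
    refine Eq.trans ?_ (lensTensor_discard (⟨[A]⟩ : Presented E) ⟨w⟩)
    -- The unitor of the empty word with itself is an identity for concatenation, so composing with
    -- it backwards changes nothing.
    refine (lensComp_id_right (C := Presented E) (toUnit (⟨[A]⟩ : Presented E) ⊗ₘ toUnit ⟨w⟩)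
      (lensTensor (zeroHom ((⟨[A]⟩ : Presented E) ⊗ 𝟙_ _) ⟨[A]⟩)
        (zeroHom ((⟨w⟩ : Presented E) ⊗ 𝟙_ _) ⟨w⟩))).symm.trans ?_
    exact congrArg (lensComp _ _) (Category.comp_id _).symm

theorem additiveChange_reverseTerm (hρ : ∀ ⦃w v : List O⦄ (s : S w v), AdditiveChange (ρ s))
    {w v : List O} (f : Term S w v) : AdditiveChange (reverseTerm ρ f) := by
  induction f with
  | gen s => exact hρ s
  | id w => exact additiveChange_snd (⟨w⟩ : Presented E)
  | swap w v => exact additiveChange_braiding (⟨w⟩ : Presented E) ⟨v⟩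
  | copy A => exact additiveChange_copy (⟨[A]⟩ : Presented E)
  | discard A => exact additiveChange_zeroHom (⟨[A]⟩ : Presented E) (𝟙_ (Presented E))
  | add A => exact additiveChange_add (⟨[A]⟩ : Presented E)
  | zero A => exact additiveChange_toUnit (⟨[A]⟩ : Presented E)
  | comp f g hf hg => exact hf.lensComp hg
  | tensor f g hf hg => exact hf.lensTensor hg

/-- Identifies the letterwise copy of the presentation with the diagonal of the product, so that
naturality of the former can be read off from lens laws stated for the latter. -/
theorem copyWordHom_eq (X : Presented E) : copyWordHom X = copyHom X := by
  apply CartesianMonoidalCategory.hom_ext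
  · rw [copyHom, lift_fst]
    exact copyWordHom_right X
  · rw [copyHom, lift_snd]
    exact copyWordHom_left X

/-- Each axiom that generates the congruence is one of the lens laws above. Additivity enters only
for the naturality of copying and discarding. -/
theorem reverseTerm_rel (hρ : ∀ ⦃w v : List O⦄ (s : S w v), AdditiveChange (ρ s))
    (hE : ∀ ⦃w v : List O⦄ (f g : Term S w v), E f g → reverseTerm ρ f = reverseTerm ρ g)
    {w v : List O} {f g : Term S w v} (h : Rel E f g) : reverseTerm ρ f = reverseTerm ρ g := by
  induction h with
  | eqn h => exact hE _ _ h
  | refl f => rfl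
  | symm _ ih => exact ih.symm
  | trans _ _ ih ih' => exact ih.trans ih'
  -- The backward part of a composite contains the forward part of its first factor, so the relation
  -- itself is used besides the induction hypotheses.
  | comp_congr h _ ih ih' =>
    rw [reverseTerm_comp, reverseTerm_comp, ih, ih', ofTerm_sound h]
  | tensor_congr _ _ ih ih' => rw [reverseTerm_tensor, reverseTerm_tensor, ih, ih']
  | id_comp f => exact lensComp_id_left (reverseTerm ρ f)
  | comp_id f => exact lensComp_id_right (ofTerm f) (reverseTerm ρ f)
  | comp_assoc f g k =>
    exact lensComp_assoc (ofTerm f) (ofTerm g) (reverseTerm ρ f) (reverseTerm ρ g) (reverseTerm ρ k)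
  | tensor_id w v => exact lensTensor_id (⟨w⟩ : Presented E) ⟨v⟩
  | tensor_comp f g f' g' =>
    exact lensTensor_lensComp (ofTerm f) (ofTerm f') (reverseTerm ρ f) (reverseTerm ρ g)
      (reverseTerm ρ f') (reverseTerm ρ g')
  | tensor_assoc f f' f'' =>
    -- The associators of the presented category are the identities between equal words, so the lens
    -- law for associators applies directly.
    simp only [reverseTerm_comp, reverseTerm_eqTo]
    exact lensTensor_assoc (ofTerm f) (ofTerm f') (ofTerm f'') (reverseTerm ρ f)
      (reverseTerm ρ f') (reverseTerm ρ f'')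
  | nil_tensor f =>
    simp only [reverseTerm_comp, reverseTerm_eqTo]
    exact lensTensor_leftUnit (ofTerm f) (reverseTerm ρ f)
  | tensor_nil f =>
    simp only [reverseTerm_comp, reverseTerm_eqTo]
    exact lensTensor_rightUnit (ofTerm f) (reverseTerm ρ f)
  | swap_natural f g =>
    exact lensTensor_braiding (ofTerm f) (ofTerm g) (reverseTerm ρ f) (reverseTerm ρ g)
  | swap_swap w v => exact lensComp_braiding_braiding (⟨w⟩ : Presented E) ⟨v⟩
  | hexagon w v x =>
    simp only [reverseTerm_comp, reverseTerm_eqTo]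
    exact lensComp_hexagon (⟨w⟩ : Presented E) ⟨v⟩ ⟨x⟩
  | copy_comm A =>
    rw [reverseTerm_comp, ← copy_singleton]
    exact lensComp_copy_braiding (⟨[A]⟩ : Presented E)
  | copy_assoc A =>
    have h := lensComp_copy_assoc (⟨[A]⟩ : Presented E)
    rw [copy_singleton] at h
    simp only [reverseTerm_comp, reverseTerm_eqTo]
    exact h
  | copy_counit A =>
    have h := lensComp_copy_counit (⟨[A]⟩ : Presented E)
    rw [copy_singleton, toUnit_unique (toUnit (⟨[A]⟩ : Presented E)) (discardGen A)] at h
    simp only [reverseTerm_comp, reverseTerm_eqTo]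
    exact h
  | copy_natural f =>
    have h := lensComp_copy_natural (ofTerm f) (additiveChange_reverseTerm ρ hρ f)
    rw [← copyWordHom_eq] at h
    simp only [reverseTerm_comp, reverseTerm_copyWord]
    exact h
  | discard_natural f =>
    rw [reverseTerm_comp, reverseTerm_discardWord, reverseTerm_discardWord]
    exact lensComp_discard_natural (ofTerm f) (additiveChange_reverseTerm ρ hρ f)
  | add_comm A => exact lensComp_braiding_add (⟨[A]⟩ : Presented E)
  | add_assoc A =>
    have h := lensComp_add_assoc (⟨[A]⟩ : Presented E)
    rw [add_singleton] at h
    simp only [reverseTerm_comp, reverseTerm_eqTo]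
    exact h
  | zero_add A =>
    have h := lensComp_zero_add (⟨[A]⟩ : Presented E)
    rw [zero_singleton] at h
    simp only [reverseTerm_comp, reverseTerm_eqTo]
    exact h

end Presented

/-! ### The first-order axioms, separated from those on second derivatives. -/

section Structural

variable {C : Type u} [Category.{v} C] [CartesianMonoidalCategory C] [BraidedCategory C]
  [CartesianLeftAdditive C]

/-- The structural axioms of a reverse differential combinator, and additivity of change: `R f` is
the backward part of a lens, functorially and monoidally in `f`. -/
structure IsStructural (R : Combinator C) : Prop where
  map_id (X : C) : R (𝟙 X) = snd X X
  map_copy (X : C) : R (copyHom X) = snd X (X ⊗ X) ≫ CartesianLeftAdditive.add X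
  map_add (X : C) : R (CartesianLeftAdditive.add X) = snd (X ⊗ X) X ≫ copyHom X
  map_twist (X Y : C) : R (β_ X Y).hom = snd (X ⊗ Y) (Y ⊗ X) ≫ (β_ Y X).hom
  map_discard (X : C) : R (toUnit X) = zeroHom (X ⊗ 𝟙_ C) X
  map_zero (X : C) : R (CartesianLeftAdditive.zero X) = toUnit (𝟙_ C ⊗ X)
  map_associator (X Y Z : C) :
    R (α_ X Y Z).hom = snd ((X ⊗ Y) ⊗ Z) (X ⊗ (Y ⊗ Z)) ≫ (α_ X Y Z).inv
  map_leftUnitor (X : C) : R (λ_ X).hom = snd (𝟙_ C ⊗ X) X ≫ (λ_ X).inv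
  map_rightUnitor (X : C) : R (ρ_ X).hom = snd (X ⊗ 𝟙_ C) X ≫ (ρ_ X).inv
  map_comp {X Y Z : C} (f : X ⟶ Y) (g : Y ⟶ Z) : R (f ≫ g) = lensComp f (R f) (R g)
  map_tensor {X Y X' Y' : C} (f : X ⟶ Y) (g : X' ⟶ Y') : R (f ⊗ₘ g) = lensTensor (R f) (R g)
  additive {X Y : C} (f : X ⟶ Y) : AdditiveChange (R f)

theorem IsReverseDerivative.isStructural {R : Combinator C} (h : IsReverseDerivative R) :
    IsStructural R where
  map_id := h.map_id
  map_copy := h.map_copy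
  map_add := h.map_add
  map_twist := h.map_twist
  map_discard := h.map_discard
  map_zero := h.map_zero
  map_associator := h.map_associator
  map_leftUnitor := h.map_leftUnitor
  map_rightUnitor := h.map_rightUnitor
  map_comp f g := (h.map_comp f g).trans (lensComp_eq _ _ _).symm
  map_tensor f g := (h.map_tensor f g).trans (lensTensor_eq _ _).symm
  additive f := additiveChange_iff.2 ⟨h.add_change f, h.zero_change f⟩

theorem IsStructural.isReverseDerivative {R : Combinator C} (h : IsStructural R)
    (hl : ∀ {X Y : C} (f : X ⟶ Y), partialForward R (R f) = fst X Y ▷ Y ≫ R f)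
    (hs : ∀ {X Y : C} (f : X ⟶ Y),
      forward R (forward R f) = tensorμ X X X X ≫ forward R (forward R f)) :
    IsReverseDerivative R where
  map_id := h.map_id
  map_copy := h.map_copy
  map_add := h.map_add
  map_twist := h.map_twist
  map_discard := h.map_discard
  map_zero := h.map_zero
  map_associator := h.map_associator
  map_leftUnitor := h.map_leftUnitor
  map_rightUnitor := h.map_rightUnitor
  map_comp f g := (h.map_comp f g).trans (lensComp_eq _ _ _)
  map_tensor f g := (h.map_tensor f g).trans (lensTensor_eq _ _)
  add_change f := (additiveChange_iff.1 (h.additive f)).1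
  zero_change f := (additiveChange_iff.1 (h.additive f)).2
  linear_change f := hl f
  symm_partials f := hs f

end Structural

/-! ### The induced combinator on a presented category, and its uniqueness. -/

namespace Presented

variable {O : Type u} {S : List O → List O → Type v} {E : Equations S} {ρ : GenReverse E}
  (hρ : ∀ ⦃w v : List O⦄ (s : S w v), AdditiveChange (ρ s))
  (hE : ∀ ⦃w v : List O⦄ (f g : Term S w v), E f g → reverseTerm ρ f = reverseTerm ρ g)

/-- The combinator determined by its values on the generating morphisms. -/
def reverse : Combinator (Presented E) := fun X Y f =>
  Quotient.lift (s := setoid E X.word Y.word)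
    (reverseTerm ρ : Term S X.word Y.word → ((X ⊗ Y : Presented E) ⟶ X))
    (fun _ _ h => reverseTerm_rel ρ hρ hE h) f

theorem reverse_eqHom {w v : List O} (h : w = v) :
    reverse hρ hE (eqHom h) = snd (⟨w⟩ : Presented E) ⟨v⟩ ≫ eqHom h.symm :=
  reverseTerm_eqTo ρ h

theorem reverse_comp {X Y Z : Presented E} (f : X ⟶ Y) (g : Y ⟶ Z) :
    reverse hρ hE (f ≫ g) = lensComp f (reverse hρ hE f) (reverse hρ hE g) := by
  induction f using Quotient.inductionOn
  induction g using Quotient.inductionOn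
  rfl

theorem reverse_tensor {X Y X' Y' : Presented E} (f : X ⟶ Y) (g : X' ⟶ Y') :
    reverse hρ hE (f ⊗ₘ g) = lensTensor (reverse hρ hE f) (reverse hρ hE g) := by
  induction f using Quotient.inductionOn
  induction g using Quotient.inductionOn
  rfl

theorem reverse_tensorμ (w w' v v' : List O) :
    reverse hρ hE (tensorμ (⟨w⟩ : Presented E) ⟨w'⟩ ⟨v⟩ ⟨v'⟩) =
      snd ((⟨w⟩ ⊗ ⟨w'⟩ : Presented E) ⊗ (⟨v⟩ ⊗ ⟨v'⟩)) ((⟨w⟩ ⊗ ⟨v⟩) ⊗ (⟨w'⟩ ⊗ ⟨v'⟩)) ≫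
        tensorμ (⟨w⟩ : Presented E) ⟨v⟩ ⟨w'⟩ ⟨v'⟩ := by
  rw [tensorμ_eq]
  exact reverseTerm_tensorμ ρ w w' v v' _ _

/-- Kept general in the operation: it is the induction step both for the addition and for the
multiplication of words. -/
theorem reverse_mulWord_cons (a : ∀ A : O, (⟨[A]⟩ : Presented E) ⊗ ⟨[A]⟩ ⟶ ⟨[A]⟩) (A : O)
    (w : List O) :
    reverse hρ hE (mulWord a (A :: w)) =
      lensComp (tensorμ (⟨[A]⟩ : Presented E) ⟨w⟩ ⟨[A]⟩ ⟨w⟩)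
        (snd ((⟨[A]⟩ ⊗ ⟨w⟩ : Presented E) ⊗ (⟨[A]⟩ ⊗ ⟨w⟩)) ((⟨[A]⟩ ⊗ ⟨[A]⟩) ⊗ (⟨w⟩ ⊗ ⟨w⟩)) ≫
          tensorμ (⟨[A]⟩ : Presented E) ⟨[A]⟩ ⟨w⟩ ⟨w⟩)
        (lensTensor (reverse hρ hE (a A)) (reverse hρ hE (mulWord a w))) := by
  refine (reverse_comp hρ hE (tensorμ (⟨[A]⟩ : Presented E) ⟨w⟩ ⟨[A]⟩ ⟨w⟩)
    (a A ⊗ₘ mulWord a w)).trans ?_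
  rw [reverse_tensor, reverse_tensorμ]

theorem reverse_add (w : List O) :
    reverse hρ hE (mulWord addGen w) = snd ((⟨w⟩ : Presented E) ⊗ ⟨w⟩) ⟨w⟩ ≫
      copyHom (⟨w⟩ : Presented E) := by
  induction w with
  | nil => exact toUnit_unique (C := Presented E) _ _
  | cons A w ih =>
    rw [reverse_mulWord_cons, ih]
    exact lensComp_tensorμ_add (⟨[A]⟩ : Presented E) ⟨w⟩

theorem isStructural_reverse : IsStructural (reverse hρ hE) where
  map_id X := rfl
  map_copy X := by
    rw [← copyWordHom_eq]
    exact reverseTerm_copyWord ρ X.word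
  map_add X := reverse_add hρ hE X.word
  map_twist X Y := rfl
  map_discard X := by
    rw [eq_discardHom (toUnit X)]
    exact reverseTerm_discardWord ρ X.word
  map_zero X := toUnit_unique (C := Presented E) _ _
  map_associator X Y Z := reverse_eqHom hρ hE _
  map_leftUnitor X := reverse_eqHom hρ hE _
  map_rightUnitor X := reverse_eqHom hρ hE _
  map_comp f g := reverse_comp hρ hE f g
  map_tensor f g := reverse_tensor hρ hE f g
  additive f := Quotient.inductionOn f fun f => additiveChange_reverseTerm ρ hρ f

/-- A combinator that satisfies the structural axioms is determined by its values on the generating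
morphisms. -/
theorem _root_.RevDiff.IsStructural.eq_of_gen {R R' : Combinator (Presented E)}
    (h : IsStructural R) (h' : IsStructural R')
    (hg : ∀ ⦃w v : List O⦄ (s : S w v), R (ofTerm (Term.gen s)) = R' (ofTerm (Term.gen s))) :
    R = R' := by
  have key : ∀ {w v : List O} (f : Term S w v), R (ofTerm f) = R' (ofTerm f) := by
    intro w v f
    induction f with
    | gen s => exact hg s
    | id w => exact (h.map_id ⟨w⟩).trans (h'.map_id ⟨w⟩).symm
    | swap w v => exact (h.map_twist ⟨w⟩ ⟨v⟩).trans (h'.map_twist ⟨w⟩ ⟨v⟩).symm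
    | copy A => rw [← copy_singleton, h.map_copy, h'.map_copy]
    | discard A =>
      have e : discardGen A = toUnit (⟨[A]⟩ : Presented E) := toUnit_unique _ _
      change R (discardGen A) = R' (discardGen A)
      rw [e, h.map_discard, h'.map_discard]
    | add A => rw [← add_singleton, h.map_add, h'.map_add]
    -- The backward part of a constant lands in its domain, the terminal object.
    | zero A => exact toUnit_unique (C := Presented E) _ _
    | comp f g hf hg => rw [ofTerm_comp, h.map_comp, h'.map_comp, hf, hg]
    | tensor f g hf hg =>
      refine (h.map_tensor (ofTerm f) (ofTerm g)).trans ?_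
      rw [hf, hg]
      exact (h'.map_tensor (ofTerm f) (ofTerm g)).symm
  funext X Y f
  exact Quotient.inductionOn f fun f => key f

end Presented

/-! ### The inclusion preserves the structure; extension of the combinator. -/

namespace DistPresented

open Presented

variable {O : Type u} {S : List O → List O → Type v} {E : Equations S}

/-- The canonical functor on objects. -/
abbrev ι (X : Presented E) : DistPresented E := ⟨X.word⟩

/-- The canonical functor on morphisms. -/
def incl {X Y : Presented E} (f : X ⟶ Y) : ι X ⟶ ι Y := (inclusion E).map f

theorem incl_id (X : Presented E) : incl (𝟙 X) = 𝟙 (ι X) := rfl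

theorem incl_comp {X Y Z : Presented E} (f : X ⟶ Y) (g : Y ⟶ Z) :
    incl (f ≫ g) = incl f ≫ incl g := (inclusion E).map_comp f g

theorem incl_eqHom {w v : List O} (h : w = v) : incl (eqHom (E := E) h) = eqHom h := by
  subst h; rfl

theorem incl_tensorHom {X Y X' Y' : Presented E} (f : X ⟶ Y) (g : X' ⟶ Y') :
    incl (f ⊗ₘ g) = incl f ⊗ₘ incl g := by
  induction f using Quotient.inductionOn
  induction g using Quotient.inductionOn
  rfl

theorem incl_toUnit (X : Presented E) : incl (toUnit X) = toUnit (ι X) :=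
  toUnit_unique (C := DistPresented E) _ _

/-- A projection is a discard map followed by a unitor, and both are kept by the inclusion.
Preservation of pairings and of the interchange follows from this. -/
theorem incl_fst (X Y : Presented E) : incl (fst X Y) = fst (ι X) (ι Y) := by
  refine (incl_comp (X ◁ discardHom Y) (ρ_ X).hom).trans ?_
  rw [← id_tensorHom, incl_tensorHom]
  refine (congrArg₂ (fun a b => (𝟙 (ι X) ⊗ₘ a) ≫ b) (incl_toUnit Y) (incl_eqHom _)).trans ?_
  rw [id_tensorHom]
  exact whiskerLeft_toUnit_comp_rightUnitor_hom (ι X) (ι Y)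

theorem incl_snd (X Y : Presented E) : incl (snd X Y) = snd (ι X) (ι Y) := by
  refine (incl_comp (discardHom X ▷ Y) (λ_ Y).hom).trans ?_
  rw [← tensorHom_id, incl_tensorHom]
  refine (congrArg₂ (fun a b => (a ⊗ₘ 𝟙 (ι Y)) ≫ b) (incl_toUnit X) (incl_eqHom _)).trans ?_
  rw [tensorHom_id]
  exact whiskerRight_toUnit_comp_leftUnitor_hom (ι X) (ι Y)

theorem incl_lift {T X Y : Presented E} (f : T ⟶ X) (g : T ⟶ Y) :
    incl (lift f g) = lift (X := ι X) (Y := ι Y) (incl f) (incl g) := by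
  apply CartesianMonoidalCategory.hom_ext (X := ι X) (Y := ι Y)
  · rw [lift_fst]
    refine (congrArg (fun k => _ ≫ k) (incl_fst X Y).symm).trans ?_
    exact (incl_comp _ _).symm.trans (congrArg incl (lift_fst f g))
  · rw [lift_snd]
    refine (congrArg (fun k => _ ≫ k) (incl_snd X Y).symm).trans ?_
    exact (incl_comp _ _).symm.trans (congrArg incl (lift_snd f g))

theorem incl_lensComp {X Y Z : Presented E} (f : X ⟶ Y) (rf : X ⊗ Y ⟶ X) (rg : Y ⊗ Z ⟶ Y) :
    incl (lensComp f rf rg) = lensComp (Z := ι Z) (incl f) (incl rf) (incl rg) := by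
  rw [lensComp_eq, lensComp_eq, incl_comp, incl_lift, incl_comp, incl_lift, incl_comp, incl_fst,
    incl_snd]

theorem incl_tensorμ (X Y Z W : Presented E) :
    incl (tensorμ X Y Z W) = tensorμ (ι X) (ι Y) (ι Z) (ι W) := by
  have h : tensorμ X Y Z W = lift (fst _ _ ⊗ₘ fst _ _) (snd _ _ ⊗ₘ snd _ _) := by ext <;> simp
  have h' : tensorμ (ι X) (ι Y) (ι Z) (ι W) = lift (fst _ _ ⊗ₘ fst _ _) (snd _ _ ⊗ₘ snd _ _) := by
    ext <;> simp
  rw [h, h', incl_lift, incl_tensorHom, incl_tensorHom, incl_fst, incl_fst, incl_snd, incl_snd]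

theorem incl_lensTensor {X Y X' Y' : Presented E} (rf : X ⊗ Y ⟶ X) (rg : X' ⊗ Y' ⟶ X') :
    incl (lensTensor rf rg) =
      lensTensor (X := ι X) (Y := ι Y) (X' := ι X') (Y' := ι Y') (incl rf) (incl rg) := by
  rw [lensTensor_eq, lensTensor_eq, incl_comp, incl_tensorHom, incl_tensorμ]

theorem incl_copyHom (X : Presented E) : incl (copyHom X) = copyHom (ι X) := by
  rw [copyHom, incl_lift]
  rfl

theorem incl_add (X : Presented E) :
    incl (CartesianLeftAdditive.add X) = CartesianLeftAdditive.add (ι X) := by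
  obtain ⟨w⟩ := X
  induction w with
  | nil => exact toUnit_unique (C := DistPresented E) _ _
  | cons A w ih =>
    refine (incl_comp (tensorμ (⟨[A]⟩ : Presented E) ⟨w⟩ ⟨[A]⟩ ⟨w⟩)
      (addGen A ⊗ₘ mulWord addGen w)).trans ?_
    rw [incl_tensorμ, incl_tensorHom]
    exact congrArg (fun k => _ ≫ (_ ⊗ₘ k)) ih

theorem incl_zero (X : Presented E) :
    incl (CartesianLeftAdditive.zero X) = CartesianLeftAdditive.zero (ι X) := by
  obtain ⟨w⟩ := X
  induction w with
  | nil => rfl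
  | cons A w ih =>
    refine (incl_comp (λ_ (𝟙_ (Presented E))).inv (zeroGen A ⊗ₘ oneWord zeroGen w)).trans ?_
    rw [incl_tensorHom]
    exact congrArg₂ (fun k l => k ≫ (zeroGen (E := DistEquations E) A ⊗ₘ l)) (incl_eqHom _) ih

theorem incl_zeroHom (X Y : Presented E) : incl (zeroHom X Y) = zeroHom (ι X) (ι Y) := by
  rw [zeroHom, incl_comp, incl_toUnit, incl_zero]
  rfl

/-- Generalized elements of the target need not come from the source, so additivity is transported
as a pair of equations between morphisms. -/
theorem incl_additiveChange {X Y : Presented E} {r : X ⊗ Y ⟶ X} (h : AdditiveChange r) :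
    AdditiveChange (X := ι X) (Y := ι Y) (incl r) := by
  obtain ⟨h₁, h₂⟩ := additiveChange_iff.1 h
  refine additiveChange_iff.2 ⟨?_, ?_⟩
  · have h := congrArg incl h₁
    rw [← id_tensorHom, ← id_tensorHom, ← id_tensorHom, incl_comp, incl_comp, incl_lift, incl_comp,
      incl_comp, incl_tensorHom, incl_tensorHom, incl_tensorHom, incl_fst, incl_snd, incl_add,
      incl_add, incl_id] at h
    rw [← id_tensorHom, ← id_tensorHom, ← id_tensorHom]
    exact h
  · have h := congrArg incl h₂
    rw [← id_tensorHom, incl_comp, incl_tensorHom, incl_zero, incl_zeroHom, incl_id] at h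
    rw [← id_tensorHom]
    exact h

/-- The reverse derivatives of the generating morphisms of the distributive category. -/
def distReverse (R : Combinator (Presented E)) : GenReverse (DistEquations E)
  | _, _, .gen s => incl (R (ofTerm (Term.gen s)))
  | _, _, .mul A => mulReverse (⟨[A]⟩ : DistPresented E)
  | _, _, .one A => toUnit (𝟙_ (DistPresented E) ⊗ ⟨[A]⟩)

variable {R : Combinator (Presented E)} (hR : IsStructural R)

include hR

theorem additiveChange_distReverse ⦃w v : List O⦄ (s : DistGen S w v) :
    AdditiveChange (distReverse R s) := by
  cases s with
  | gen s => exact incl_additiveChange (hR.additive _)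
  | mul A => exact additiveChange_mulReverse _
  | one A => exact additiveChange_toUnit (⟨[A]⟩ : DistPresented E)

/-- On included terms the recursion and `R` obey the same structural rules and agree on generators.
This gives both the invariance under `E` and the condition that the new combinator extends `R`. -/
theorem reverseTerm_incl {w v : List O} (f : Term S w v) :
    reverseTerm (distReverse R) f.incl = incl (R (ofTerm f)) := by
  induction f with
  | gen s => rfl
  | id w =>
    refine Eq.trans ?_ (congrArg incl (hR.map_id ⟨w⟩)).symm
    exact (incl_snd (⟨w⟩ : Presented E) ⟨w⟩).symm
  | swap w v =>
    refine Eq.trans ?_ (congrArg incl (hR.map_twist ⟨w⟩ ⟨v⟩)).symm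
    rw [incl_comp, incl_snd]
    rfl
  | copy A =>
    rw [← copy_singleton, hR.map_copy, incl_comp, incl_snd, incl_add]
    rfl
  | discard A =>
    refine Eq.trans ?_ (congrArg incl (congrArg (@R _ _) (toUnit_unique (discardGen A)
      (toUnit (⟨[A]⟩ : Presented E))))).symm
    rw [hR.map_discard, incl_zeroHom]
    rfl
  | add A =>
    rw [← add_singleton, hR.map_add, incl_comp, incl_snd, incl_copyHom]
    rfl
  | zero A => exact toUnit_unique (C := DistPresented E) _ _
  | comp f g hf hg =>
    rw [ofTerm_comp, hR.map_comp, incl_lensComp, ← hf, ← hg]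
    rfl
  | tensor f g hf hg =>
    refine Eq.trans ?_ (congrArg incl (hR.map_tensor (ofTerm f) (ofTerm g))).symm
    rw [incl_lensTensor, ← hf, ← hg]
    rfl

theorem reverseTerm_distEquations ⦃w v : List O⦄ (f g : Term (DistGen S) w v)
    (h : DistEquations E f g) :
    reverseTerm (distReverse R) f = reverseTerm (distReverse R) g := by
  cases h with
  | eqn h =>
    -- Both sides are images of `R` at the same morphism, since the two terms are already equal in
    -- the left-additive category.
    rw [reverseTerm_incl hR, reverseTerm_incl hR, ofTerm_sound (.eqn h)]
  | mul_comm A => exact lensComp_braiding_mul (⟨[A]⟩ : DistPresented E)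
  | mul_assoc A =>
    have h := lensComp_mul_assoc (⟨[A]⟩ : DistPresented E)
    rw [mul_singleton] at h
    simp only [reverseTerm_comp, reverseTerm_eqTo]
    exact h
  | one_mul A =>
    have h := lensComp_one_mul (⟨[A]⟩ : DistPresented E)
    rw [one_singleton] at h
    simp only [reverseTerm_comp, reverseTerm_eqTo]
    exact h
  | mul_add A =>
    have h := lensComp_mul_add (⟨[A]⟩ : DistPresented E)
    rw [add_singleton, copy_singleton, mul_singleton] at h
    have hc : reverseTerm (distReverse R) (Term.copy A) =
        snd (⟨[A]⟩ : DistPresented E) (⟨[A]⟩ ⊗ ⟨[A]⟩) ≫ ofTerm (Term.add A) := by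
      rw [← add_singleton]; rfl
    have ha : reverseTerm (distReverse R) (Term.add A) =
        snd ((⟨[A]⟩ : DistPresented E) ⊗ ⟨[A]⟩) ⟨[A]⟩ ≫ ofTerm (Term.copy A) := by
      rw [← copy_singleton]; rfl
    -- The axiom spells the interchange out by swaps and reassociations, whereas the lens law uses
    -- `tensorμ`; this matches their backward parts.
    have hμ := reverseTerm_tensorμ (distReverse R) [A] [A] [A] [A] (by simp) (by simp)
    rw [tensorμ_eq] at h hμ
    rw [← hc, ← ha] at h
    rw [reverseTerm_comp, reverseTerm_comp, reverseTerm_comp_comp_comp]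
    exact h.trans (congrArg (fun r => lensComp _ _ (lensComp _ r _)) hμ.symm)
  | mul_zero A =>
    have h := lensComp_mul_zero (⟨[A]⟩ : DistPresented E)
    rw [zero_singleton, toUnit_unique (toUnit (⟨[A]⟩ : DistPresented E)) (discardGen A)] at h
    simp only [reverseTerm_comp, reverseTerm_eqTo]
    exact h

/-- The combinator on the distributive category. -/
def distCombinator : Combinator (DistPresented E) :=
  reverse (additiveChange_distReverse hR) (reverseTerm_distEquations hR)

theorem isStructural_distCombinator : IsStructural (distCombinator hR) :=
  isStructural_reverse _ _

theorem distCombinator_incl {X Y : Presented E} (f : X ⟶ Y) :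
    distCombinator hR (incl f) = incl (R f) := by
  induction f using ind with
  | h f => exact reverseTerm_incl hR f

/-- The value is prescribed on single letters only. It propagates to words because multiplication,
and with it the expected reverse derivative, is componentwise. -/
theorem distCombinator_mul (X : DistPresented E) :
    distCombinator hR (CartesianDistributive.mul X) = mulReverse X := by
  obtain ⟨w⟩ := X
  change reverse _ _ (mulWord mulGen w) = _
  induction w with
  | nil => exact toUnit_unique (C := DistPresented E) _ _
  | cons A w ih =>
    rw [reverse_mulWord_cons, ih]
    exact lensComp_tensorμ_mul (⟨[A]⟩ : DistPresented E) ⟨w⟩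

theorem distCombinator_one (X : DistPresented E) :
    distCombinator hR (CartesianDistributive.one X) = toUnit (𝟙_ (DistPresented E) ⊗ X) :=
  toUnit_unique (C := DistPresented E) _ _

end DistPresented

/-! ### Forward derivatives and the second-derivative axioms. -/

section Calculus

variable {C : Type u} [Category.{v} C] [CartesianMonoidalCategory C] [BraidedCategory C]

section

variable [CartesianLeftAdditive C] {R : Combinator C}

attribute [simp] comp_lift_assoc

theorem lift_forward {T X Y : C} (f : X ⟶ Y) (x x' : T ⟶ X) :
    lift x x' ≫ forward R f = lift (lift x 0) x' ≫ R (R f) ≫ snd X Y := by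
  simp [forward]

namespace IsStructural

variable (h : IsStructural R)
include h

theorem lift_comp {T X Y Z : C} (f : X ⟶ Y) (g : Y ⟶ Z) (x : T ⟶ X) (z : T ⟶ Z) :
    lift x z ≫ R (f ≫ g) = lift x (lift (x ≫ f) z ≫ R g) ≫ R f := by
  rw [h.map_comp, lift_lensComp]

/-- A pairing is copying followed by a product of maps, and copying is reversed by addition: the two
changes of `x` add up. -/
theorem lift_pair {T X Y Z : C} (f : X ⟶ Y) (g : X ⟶ Z) (x : T ⟶ X) (y : T ⟶ Y ⊗ Z) :
    lift x y ≫ R (lift f g) = lift x (y ≫ fst Y Z) ≫ R f + lift x (y ≫ snd Y Z) ≫ R g := by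
  obtain ⟨y, z, rfl⟩ := exists_lift y
  have e : lift f g = copyHom X ≫ (f ⊗ₘ g) := by simp [copyHom]
  rw [e, h.lift_comp, h.map_copy, h.map_tensor, comp_copyHom, lift_lensTensor]
  simp

theorem lift_pair_assoc {T X Y Z V : C} (f : X ⟶ Y) (g : X ⟶ Z) (x : T ⟶ X) (y : T ⟶ Y ⊗ Z)
    (m : X ⟶ V) :
    lift x y ≫ R (lift f g) ≫ m =
      (lift x (y ≫ fst Y Z) ≫ R f + lift x (y ≫ snd Y Z) ≫ R g) ≫ m := by
  rw [← Category.assoc, h.lift_pair]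

theorem lift_id {T X : C} (x y : T ⟶ X) : lift x y ≫ R (𝟙 X) = y := by
  rw [h.map_id, CartesianMonoidalCategory.lift_snd]

theorem lift_toUnit {T X : C} (x : T ⟶ X) (y : T ⟶ 𝟙_ C) : lift x y ≫ R (toUnit X) = 0 := by
  simp [h.map_discard]

/-- The discarded factor receives the change zero, by the rule for discard maps. -/
theorem lift_fst {T X Y : C} (x : T ⟶ X ⊗ Y) (y : T ⟶ X) : lift x y ≫ R (fst X Y) = lift y 0 := by
  obtain ⟨x, x', rfl⟩ := exists_lift x
  have e : fst X Y = (𝟙 X ⊗ₘ toUnit Y) ≫ (ρ_ X).hom := by simp [rightUnitor_hom]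
  rw [e, h.lift_comp, h.map_tensor, h.map_rightUnitor,
    CartesianMonoidalCategory.lift_snd_assoc, comp_rightUnitor_inv, lift_lensTensor, h.lift_id,
    h.lift_toUnit]

theorem lift_snd {T X Y : C} (x : T ⟶ X ⊗ Y) (y : T ⟶ Y) : lift x y ≫ R (snd X Y) = lift 0 y := by
  obtain ⟨x, x', rfl⟩ := exists_lift x
  have e : snd X Y = (toUnit X ⊗ₘ 𝟙 Y) ≫ (λ_ Y).hom := by simp [leftUnitor_hom]
  rw [e, h.lift_comp, h.map_tensor, h.map_leftUnitor,
    CartesianMonoidalCategory.lift_snd_assoc, comp_leftUnitor_inv, lift_lensTensor, h.lift_id,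
    h.lift_toUnit]

theorem lift_snd_assoc {T X Y V : C} (x : T ⟶ X ⊗ Y) (y : T ⟶ Y) (m : X ⊗ Y ⟶ V) :
    lift x y ≫ R (snd X Y) ≫ m = lift 0 y ≫ m := by
  rw [← Category.assoc, h.lift_snd]

theorem lift_homAdd {T X Y : C} (f g : X ⟶ Y) (x : T ⟶ X) (y : T ⟶ Y) :
    lift x y ≫ R (f + g) = lift x y ≫ R f + lift x y ≫ R g := by
  rw [← lift_comp_add, h.lift_comp, h.map_add, h.lift_pair]
  simp

theorem lift_homAdd_assoc {T X Y V : C} (f g : X ⟶ Y) (x : T ⟶ X) (y : T ⟶ Y) (m : X ⟶ V) :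
    lift x y ≫ R (f + g) ≫ m = (lift x y ≫ R f + lift x y ≫ R g) ≫ m := by
  rw [← Category.assoc, h.lift_homAdd]

theorem lift_homZero {T X Y : C} (x : T ⟶ X) (y : T ⟶ Y) : lift x y ≫ R (0 : X ⟶ Y) = 0 := by
  rw [← zeroHom_eq, zeroHom, h.lift_comp, h.lift_toUnit]

theorem lift_zero {T X Y : C} (f : X ⟶ Y) (x : T ⟶ X) : lift x (0 : T ⟶ Y) ≫ R f = 0 :=
  (h.additive f).lift_zero x

theorem lift_zero_assoc {T X Y V : C} (f : X ⟶ Y) (x : T ⟶ X) (m : X ⟶ V) :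
    lift x (0 : T ⟶ Y) ≫ R f ≫ m = 0 ≫ m := by
  rw [← Category.assoc, h.lift_zero]

theorem reverse_comp {X Y Z : C} (f : X ⟶ Y) (g : Y ⟶ Z) :
    R (f ≫ g) = lift (fst X Z) (lift (fst X Z ≫ f) (snd X Z) ≫ R g) ≫ R f := by
  rw [h.map_comp, lensComp_eq]

theorem reverse_lift {X Y Z : C} (f : X ⟶ Y) (g : X ⟶ Z) :
    R (lift f g) = lift (fst X (Y ⊗ Z)) (snd X (Y ⊗ Z) ≫ fst Y Z) ≫ R f +
      lift (fst X (Y ⊗ Z)) (snd X (Y ⊗ Z) ≫ snd Y Z) ≫ R g :=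
  hom_ext_elements fun T x y => by simp [h.lift_pair]

theorem reverse_fst (X Y : C) : R (fst X Y) = lift (snd (X ⊗ Y) X) 0 :=
  hom_ext_elements fun T x y => by simp [h.lift_fst]

theorem reverse_snd (X Y : C) : R (snd X Y) = lift 0 (snd (X ⊗ Y) Y) :=
  hom_ext_elements fun T x y => by simp [h.lift_snd]

theorem reverse_homAdd {X Y : C} (f g : X ⟶ Y) : R (f + g) = R f + R g :=
  hom_ext_elements fun T x y => by simp [h.lift_homAdd]

theorem reverse_homZero (X Y : C) : R (0 : X ⟶ Y) = 0 :=
  hom_ext_elements fun T x y => by simp [h.lift_homZero]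

/-- The forward chain rule comes from applying the reverse one twice. Since `D` evaluates at change
zero, additivity gives `R g (f x, 0) = 0`, so `R (R f)` is taken at `(x, 0)`, where it yields `D f`.
-/
theorem forward_comp {X Y Z : C} (f : X ⟶ Y) (g : Y ⟶ Z) :
    forward R (f ≫ g) = lift (fst X X ≫ f) (forward R f) ≫ forward R g :=
  hom_ext_elements fun T x x' => by
    simp [lift_forward, h.reverse_comp, h.lift_pair, h.lift_fst, h.lift_snd, h.lift_zero]

theorem forward_lift {X Y Z : C} (f : X ⟶ Y) (g : X ⟶ Z) :
    forward R (lift f g) = lift (forward R f) (forward R g) :=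
  hom_ext_elements fun T x x' => by
    ext <;> simp [lift_forward, h.reverse_lift, h.lift_homAdd_assoc, h.lift_comp, h.lift_fst,
      h.lift_snd]

theorem forward_fst (X Y : C) : forward R (fst X Y) = snd (X ⊗ Y) (X ⊗ Y) ≫ fst X Y :=
  hom_ext_elements fun T x x' => by
    simp [lift_forward, h.reverse_fst, h.lift_pair_assoc, h.lift_snd, h.lift_homZero]

theorem forward_snd (X Y : C) : forward R (snd X Y) = snd (X ⊗ Y) (X ⊗ Y) ≫ snd X Y :=
  hom_ext_elements fun T x x' => by
    simp [lift_forward, h.reverse_snd, h.lift_pair_assoc, h.lift_homZero]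

theorem forward_id (X : C) : forward R (𝟙 X) = snd X X :=
  hom_ext_elements fun T x x' => by
    simp [lift_forward, h.map_id, h.lift_snd_assoc]

theorem forward_homAdd {X Y : C} (f g : X ⟶ Y) : forward R (f + g) = forward R f + forward R g :=
  hom_ext_elements fun T x x' => by
    simp [lift_forward, h.reverse_homAdd]

theorem forward_homZero (X Y : C) : forward R (0 : X ⟶ Y) = 0 :=
  hom_ext_elements fun T x x' => by
    simp [lift_forward, h.reverse_homZero]

/-- Removes the derivatives of the base point when only the change is varied, as in the linearity
axiom for composites and products. -/
theorem lift_forward_zero {T X Y : C} (f : X ⟶ Y) (x : T ⟶ X) :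
    lift x (0 : T ⟶ X) ≫ forward R f = 0 := by
  simp [lift_forward, h.lift_zero_assoc]

end IsStructural

/-- The axioms on second derivatives of a reverse differential combinator, for a single
morphism: linearity of change and symmetry of the partial derivatives. -/
structure IsSmooth (R : Combinator C) {X Y : C} (f : X ⟶ Y) : Prop where
  linear {T : C} (x : T ⟶ X) (y y' : T ⟶ Y) :
    lift (lift x y) (lift 0 y') ≫ forward R (R f) = lift x y' ≫ R f
  symm {T : C} (x a b c : T ⟶ X) :
    lift (lift x a) (lift b c) ≫ forward R (forward R f) =
      lift (lift x b) (lift a c) ≫ forward R (forward R f)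

theorem isSmooth_iff {X Y : C} {f : X ⟶ Y} :
    IsSmooth R f ↔ partialForward R (R f) = fst X Y ▷ Y ≫ R f ∧
      forward R (forward R f) = tensorμ X X X X ≫ forward R (forward R f) := by
  constructor
  · rintro ⟨h, h'⟩
    constructor
    · refine hom_ext_elements fun T x y' => ?_
      obtain ⟨x, y, rfl⟩ := exists_lift x
      simpa [partialForward] using h x y y'
    · refine hom_ext_elements fun T x y => ?_
      obtain ⟨x, a, rfl⟩ := exists_lift x
      obtain ⟨b, c, rfl⟩ := exists_lift y
      simpa using h' x a b c
  · rintro ⟨h, h'⟩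
    constructor
    · intro T x y y'
      simpa [partialForward] using congrArg (fun k => lift (lift x y) y' ≫ k) h
    · intro T x a b c
      simpa using congrArg (fun k => lift (lift x a) (lift b c) ≫ k) h'

/-! ### Closure of smoothness under the cartesian and additive operations. -/

namespace IsStructural

variable (h : IsStructural R)
include h

theorem isSmooth_comp {X Y Z : C} {f : X ⟶ Y} {g : Y ⟶ Z} (hf : IsSmooth R f)
    (hg : IsSmooth R g) : IsSmooth R (f ≫ g) where
  linear x z z' := by
    simp [h.reverse_comp, h.forward_comp, h.forward_lift, h.forward_fst, h.forward_snd,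
      h.lift_forward_zero, hf.linear, hg.linear]
  symm x a b c := by
    simp [h.forward_comp, h.forward_lift, h.forward_fst]
    -- The second derivative of `f ≫ g` is that of `g` at `((f x, D f (x, a)), (D f (x, b), D D f
    -- ((x, a), (b, c))))`. Symmetry for `f` treats the last entry and symmetry for `g` exchanges
    -- the middle two.
    rw [hf.symm x a b c, hg.symm]

theorem isSmooth_lift {X Y Z : C} {f : X ⟶ Y} {g : X ⟶ Z} (hf : IsSmooth R f)
    (hg : IsSmooth R g) : IsSmooth R (lift f g) where
  linear x y y' := by
    simp [h.reverse_lift, h.forward_homAdd, h.forward_comp, h.forward_lift, h.forward_fst,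
      h.forward_snd, hf.linear, hg.linear]
  symm x a b c := by
    simp [h.forward_lift, hf.symm x a b c, hg.symm x a b c]

theorem isSmooth_fst (X Y : C) : IsSmooth R (fst X Y) where
  linear x y y' := by
    simp [h.reverse_fst, h.forward_lift, h.forward_snd, h.forward_homZero]
  symm x a b c := by
    simp [h.forward_fst, h.forward_comp, h.forward_snd]

theorem isSmooth_snd (X Y : C) : IsSmooth R (snd X Y) where
  linear x y y' := by
    simp [h.reverse_snd, h.forward_lift, h.forward_snd, h.forward_homZero]
  symm x a b c := by
    simp [h.forward_snd, h.forward_comp]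

theorem isSmooth_id (X : C) : IsSmooth R (𝟙 X) where
  linear x y y' := by simp [h.map_id, h.forward_snd]
  symm x a b c := by simp [h.forward_id, h.forward_snd]

/-- For a constant, `R f` has terminal codomain and hence equals zero, so all derivatives vanish.
This covers zeros and units alike. -/
theorem isSmooth_of_unit {X : C} (f : 𝟙_ C ⟶ X) : IsSmooth R f := by
  have hr : R f = 0 := toUnit_unique _ _
  have hf : forward R f = 0 :=
    hom_ext_elements fun T x x' => by simp [lift_forward, hr, h.reverse_homZero]
  exact ⟨fun x y y' => toUnit_unique _ _, fun x a b c => by simp [hf, h.forward_homZero]⟩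

theorem isSmooth_homZero (X Y : C) : IsSmooth R (0 : X ⟶ Y) where
  linear x y y' := by simp [h.reverse_homZero, h.forward_homZero]
  symm x a b c := by simp [h.forward_homZero]

theorem isSmooth_homAdd {X Y : C} {f g : X ⟶ Y} (hf : IsSmooth R f) (hg : IsSmooth R g) :
    IsSmooth R (f + g) where
  linear x y y' := by
    simp [h.reverse_homAdd, h.forward_homAdd, hf.linear, hg.linear]
  symm x a b c := by
    simp [h.forward_homAdd, hf.symm x a b c, hg.symm x a b c]

theorem isSmooth_tensorHom {X Y X' Y' : C} {f : X ⟶ Y} {g : X' ⟶ Y'} (hf : IsSmooth R f)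
    (hg : IsSmooth R g) : IsSmooth R (f ⊗ₘ g) := by
  rw [← lift_fst_comp_snd_comp]
  exact h.isSmooth_lift (h.isSmooth_comp (h.isSmooth_fst _ _) hf)
    (h.isSmooth_comp (h.isSmooth_snd _ _) hg)

end IsStructural

end

/-! ### The Leibniz rule, and smoothness of products. -/

section

variable [CartesianDistributive C] {R : Combinator C} (h : IsStructural R)
  (hm : ∀ X : C, R (CartesianDistributive.mul X) = mulReverse X)

namespace IsStructural

include h hm

theorem lift_homMul {T X Y : C} (f g : X ⟶ Y) (x : T ⟶ X) (y : T ⟶ Y) :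
    lift x y ≫ R (f * g) = lift x ((x ≫ g) * y) ≫ R f + lift x ((x ≫ f) * y) ≫ R g := by
  rw [← lift_comp_mul, h.lift_comp, hm, h.lift_pair]
  simp

theorem reverse_homMul {X Y : C} (f g : X ⟶ Y) :
    R (f * g) = lift (fst X Y) ((fst X Y ≫ g) * snd X Y) ≫ R f +
      lift (fst X Y) ((fst X Y ≫ f) * snd X Y) ≫ R g :=
  hom_ext_elements fun T x y => by simp [h.lift_homMul hm]

/-- Differentiating `R f (x, g x · d) + R g (x, f x · d)` in `d` at `d = 0`: each inner change is
zero there, so the two summands give `D f` and `D g`, multiplied by the other factor. -/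
theorem forward_homMul {X Y : C} (f g : X ⟶ Y) :
    forward R (f * g) = (fst X X ≫ f) * forward R g + forward R f * (fst X X ≫ g) :=
  hom_ext_elements fun T x x' => by
    simp [lift_forward, h.reverse_homMul hm, h.lift_homAdd_assoc,
      h.lift_pair_assoc, h.lift_comp, h.lift_fst, h.lift_snd, h.lift_zero]
    ring

theorem isSmooth_homMul {X Y : C} {f g : X ⟶ Y} (hf : IsSmooth R f) (hg : IsSmooth R g) :
    IsSmooth R (f * g) where
  linear x y y' := by
    simp [h.reverse_homMul hm, h.forward_homAdd, h.forward_homMul hm, h.forward_comp,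
      h.forward_lift, h.forward_fst, h.forward_snd, h.lift_forward_zero, hf.linear, hg.linear]
  symm x a b c := by
    simp [h.forward_homMul hm, h.forward_homAdd, h.forward_comp, h.forward_fst,
      hf.symm x a b c, hg.symm x a b c]
    ring

end IsStructural

end

end Calculus

/-! ### Verification of the axioms and uniqueness. -/

namespace DistPresented

open Presented

variable {O : Type u} {S : List O → List O → Type v} {E : Equations S}
  {R : Combinator (Presented E)}

/-- The forward derivative is built from `R`, pairings and zeros, all of which the inclusion
preserves, so a combinator extending `R` extends its forward derivative as well. -/
theorem forward_incl {R' : Combinator (DistPresented E)}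
    (hR' : ∀ {X Y : Presented E} (f : X ⟶ Y), R' (incl f) = incl (R f))
    {X Y : Presented E} (f : X ⟶ Y) : forward R' (incl f) = incl (forward R f) := by
  have hRR : R' (R' (incl f)) = incl (R (R f)) := by
    rw [hR']
    exact hR' (R f)
  rw [forward, forward, hRR, incl_comp, incl_lift, incl_lift, incl_comp, incl_fst, incl_snd,
    incl_zeroHom, incl_snd]
  rfl

theorem partialForward_incl {R' : Combinator (DistPresented E)}
    (hR' : ∀ {X Y : Presented E} (f : X ⟶ Y), R' (incl f) = incl (R f))
    {X Y Z : Presented E} (g : X ⊗ Y ⟶ Z) :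
    partialForward (X := ι X) (Y := ι Y) R' (incl g) = incl (partialForward R g) := by
  have h := forward_incl hR' g
  rw [partialForward, partialForward, incl_comp, incl_lift, incl_lift, incl_fst, incl_snd,
    incl_zeroHom, ← h]
  rfl

theorem isSmooth_incl {R' : Combinator (DistPresented E)}
    (hR' : ∀ {X Y : Presented E} (f : X ⟶ Y), R' (incl f) = incl (R f))
    {X Y : Presented E} {f : X ⟶ Y} (h : IsSmooth R f) : IsSmooth R' (incl f) := by
  obtain ⟨h₁, h₂⟩ := isSmooth_iff.1 h
  refine isSmooth_iff.2 ⟨?_, ?_⟩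
  · have h := congrArg incl h₁
    rw [← partialForward_incl hR', ← tensorHom_id, incl_comp, incl_tensorHom, incl_fst, incl_id]
      at h
    rw [← tensorHom_id, hR']
    exact h
  · have h := congrArg incl h₂
    rw [incl_comp, incl_tensorμ, ← forward_incl hR'] at h
    rw [forward_incl hR']
    exact h

theorem isSmooth_ofTerm (hR : IsReverseDerivative R) {R' : Combinator (DistPresented E)}
    (hR' : ∀ {X Y : Presented E} (f : X ⟶ Y), R' (incl f) = incl (R f))
    (h : IsStructural R')
    (hm : ∀ X : DistPresented E, R' (CartesianDistributive.mul X) = mulReverse X)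
    {w v : List O} (f : Term (DistGen S) w v) :
    IsSmooth R' (ofTerm (E := DistEquations E) f) := by
  induction f with
  | gen s =>
    cases s with
    | gen s =>
      -- The only place where the second-derivative axioms of the given `R` enter.
      exact isSmooth_incl hR' (f := ofTerm (Term.gen s))
        (isSmooth_iff.2 ⟨hR.linear_change _, hR.symm_partials _⟩)
    | mul A =>
      have e := mul_singleton (E := E) A
      rw [mul_eq_fst_mul_snd] at e
      exact (congrArg (IsSmooth R') e).mp
        (h.isSmooth_homMul hm (h.isSmooth_fst ⟨[A]⟩ ⟨[A]⟩) (h.isSmooth_snd ⟨[A]⟩ ⟨[A]⟩))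
    | one A => exact h.isSmooth_of_unit (X := ⟨[A]⟩) _
  | id w => exact h.isSmooth_id ⟨w⟩
  | swap w v =>
    -- The swap is the pairing of the two projections in reverse order.
    exact (congrArg (IsSmooth R') (lift_snd_fst (X := (⟨w⟩ : DistPresented E)) (Y := ⟨v⟩))).mp
      (h.isSmooth_lift (h.isSmooth_snd ⟨w⟩ ⟨v⟩) (h.isSmooth_fst ⟨w⟩ ⟨v⟩))
  | copy A =>
    exact (congrArg (IsSmooth R') (copy_singleton (E := DistEquations E) A)).mp
      (h.isSmooth_lift (h.isSmooth_id ⟨[A]⟩) (h.isSmooth_id ⟨[A]⟩))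
  | discard A =>
    have e : (0 : (⟨[A]⟩ : DistPresented E) ⟶ 𝟙_ (DistPresented E)) = discardGen A :=
      toUnit_unique _ _
    exact (congrArg (IsSmooth R') e).mp (h.isSmooth_homZero _ _)
  | add A =>
    have e := add_singleton (E := DistEquations E) A
    rw [add_eq_fst_add_snd] at e
    exact (congrArg (IsSmooth R') e).mp
      (h.isSmooth_homAdd (h.isSmooth_fst ⟨[A]⟩ ⟨[A]⟩) (h.isSmooth_snd ⟨[A]⟩ ⟨[A]⟩))
  | zero A => exact h.isSmooth_of_unit (X := ⟨[A]⟩) _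
  | comp f g hf hg => exact h.isSmooth_comp hf hg
  | tensor f g hf hg => exact h.isSmooth_tensorHom hf hg

theorem isReverseDerivative (hR : IsReverseDerivative R) {R' : Combinator (DistPresented E)}
    (hR' : ∀ {X Y : Presented E} (f : X ⟶ Y), R' (incl f) = incl (R f))
    (h : IsStructural R')
    (hm : ∀ X : DistPresented E, R' (CartesianDistributive.mul X) = mulReverse X) :
    IsReverseDerivative R' := by
  have key : ∀ {X Y : DistPresented E} (f : X ⟶ Y), IsSmooth R' f := fun f =>
    Quotient.inductionOn f fun f => isSmooth_ofTerm hR hR' h hm f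
  exact h.isReverseDerivative (fun f => (isSmooth_iff.1 (key f)).1)
    (fun f => (isSmooth_iff.1 (key f)).2)

theorem eq_distCombinator (hR : IsStructural R) {R' : Combinator (DistPresented E)}
    (hR' : ∀ {X Y : Presented E} (f : X ⟶ Y), R' (incl f) = incl (R f))
    (h : IsStructural R')
    (hm : ∀ X : DistPresented E, R' (CartesianDistributive.mul X) = mulReverse X) :
    R' = distCombinator hR := by
  refine h.eq_of_gen (isStructural_distCombinator hR) ?_
  intro w v s
  cases s with
  | gen s => exact hR' (ofTerm (Term.gen s))
  | mul A =>
    change R' (ofTerm (Term.mul A)) = distCombinator hR (ofTerm (Term.mul A))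
    rw [← mul_singleton, hm, distCombinator_mul]
  -- The codomain of the reverse derivative of a unit is terminal, which leaves no choice.
  | one A => exact toUnit_unique (C := DistPresented E) _ _

end DistPresented

end RevDiff

theorem theorem3 {O : Type u} {S : List O → List O → Type v} (E : RevDiff.Equations S)
    (R : RevDiff.Combinator (RevDiff.Presented E)) (hR : RevDiff.IsReverseDerivative R) :
    ∃! R' : RevDiff.Combinator (RevDiff.DistPresented E),
      RevDiff.IsReverseDerivative R' ∧
      (∀ (X Y : RevDiff.Presented E) (f : X ⟶ Y),
        R' ((RevDiff.inclusion E).map f) = (RevDiff.inclusion E).map (R f)) ∧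
      (∀ X : RevDiff.DistPresented E,
        R' (RevDiff.CartesianDistributive.mul X) =
          lift (lift (fst (X ⊗ X) X ≫ snd X X) (snd (X ⊗ X) X) ≫
              RevDiff.CartesianDistributive.mul X)
            (lift (fst (X ⊗ X) X ≫ fst X X) (snd (X ⊗ X) X) ≫
              RevDiff.CartesianDistributive.mul X)) ∧
      (∀ X : RevDiff.DistPresented E,
        R' (RevDiff.CartesianDistributive.one X) = toUnit (𝟙_ (RevDiff.DistPresented E) ⊗ X)) := by
  refine ⟨RevDiff.DistPresented.distCombinator hR.isStructural, ⟨?_, ?_, ?_, ?_⟩, ?_⟩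
  · exact RevDiff.DistPresented.isReverseDerivative hR
      (RevDiff.DistPresented.distCombinator_incl _)
      (RevDiff.DistPresented.isStructural_distCombinator _)
      (RevDiff.DistPresented.distCombinator_mul _)
  · exact fun X Y f => RevDiff.DistPresented.distCombinator_incl hR.isStructural f
  · exact RevDiff.DistPresented.distCombinator_mul _
  · exact RevDiff.DistPresented.distCombinator_one _
  · rintro R' ⟨h, hi, hm, -⟩
    exact RevDiff.DistPresented.eq_distCombinator hR.isStructural (fun f => hi _ _ f)
      h.isStructural hm
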